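/- **Setting.** Let $X\subset\mathbb R^N$ and $Y\subset\mathbb R^P$ be (the underlying spaces of) geometric simplicial complexes, $X$ locally finite, and let $f\colon X\to Y$ be a surjective simplicial map (it sends the vertices of each simplex of $X$ onto the vertices of a simplex of $Y$ and is affine on each simplex) all of whose fibres are finite. For $k\ge 1$ let $$W^k(f)=\{(x_1,\dots,x_k)\in X^k: f(x_1)=\dots=f(x_k)\},$$ and let $D^k(f)\subseteq W^k(f)$ be the closure in $X^k$ of $\{(x_1,\dots,x_k)\in W^k(f): x_i\ne x_j \text{ for } i\ne j\}$. The space $W^k(f)$ is triangulated by the simplices with vertices $(v^{(1)}_j,\dots,v^{(k)}_j)$, $0\le j\le n$, where for each $\ell$ the points $v^{(\ell)}_0,\dots,v^{(\ell)}_n$ are the vertices of an $n$-simplex of $X$, and $f(v^{(\ell)}_j)=w_j$ is independent of $\ell$ with $w_0,\dots,w_n$ distinct; $D^k(f)$ is triangulated by those simplices of $W^k(f)$ that it contains. Let $C_n(\cdot)$ denote simplicial $n$-chains with integer coefficients (generated by the ordered $n$-simplices $[v_0,\dots,v_n]$, modulo $[v_{\tau(0)},\dots,v_{\tau(n)}]=\operatorname{sign}(\tau)[v_0,\dots,v_n]$),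 $\partial$ the boundary map and $H_*$ its homology. The symmetric group $S_k$ acts on $D^k(f)$ by permuting components; let $$C_n^{\mathrm{Alt}}(D^k(f))=\{c\in C_n(D^k(f)):\sigma_\#c=\operatorname{sign}(\sigma)\,c\ \text{ for all }\sigma\in S_k\},$$ a subcomplex with respect to $\partial$, and let $AH_*(D^k(f))$ be its homology. Let $\varepsilon^{i,k}$ be the projection forgetting the $i$-th of $k$ components, and set $$\varrho^k_n=(-1)^n\sum_{i=1}^k(-1)^{i-1}\varepsilon^{i,k}_{\#}\colon C_n(W^k(f))\to C_n(W^{k-1}(f)),\qquad \epsilon^k_n=(-1)^n\varepsilon^{k,k}_{\#}\colon C^{\mathrm{Alt}}_n(D^k(f))\to C^{\mathrm{Alt}}_n(D^{k-1}(f))\qquad(k\ge2).$$ These give two first quadrant double complexes with anticommuting differentials: the *fibred-power double complex* $C_{n,k}=C_n(W^{k+1}(f))$ with $d'=\partial$, $d''=\varrho$, and the *alternating double complex* $C_{n,k}=C_n^{\mathrm{Alt}}(D^{k+1}(f))$ with $d'=\partial$, $d''=\epsilon$ ($n,k\ge0$). The *second spectral sequence* of a double complex $C$ is the spectral sequence of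 its total complex $\mathrm{Tot}(C)_n=\bigoplus_{i+j=n}C_{i,j}$, $D=d'+d''$, filtered by $F^p\,\mathrm{Tot}(C)_n=\bigoplus_{j\le p}C_{n-j,j}$; its differentials are $d^r\colon E^r_{p,q}\to E^r_{p-r,q+r-1}$. A first quadrant spectral sequence *converges* to a graded group $H_*$, written $E^r_{p,q}\Longrightarrow H_{p+q}$, if each $H_n$ has a filtration $0=F_{-1}H_n\subseteq F_0H_n\subseteq\dots\subseteq F_nH_n=H_n$ with $E^\infty_{p,q}\cong F_pH_{p+q}/F_{p-1}H_{p+q}$, where $E^\infty_{p,q}$ is the stable value $E^r_{p,q}$, $r>\max\{p,q+1\}$. **Corollary (GVZSS and ICSS).** 1. The second spectral sequence of the fibred-power double complex (the GVZ spectral sequence) is a first quadrant spectral sequence with $$E^1_{p,q}\cong H_q(W^{p+1}(f))\Longrightarrow H_{p+q}(Y).$$ Under these isomorphisms the differential $d^1\colon E^1_{p,q}\to E^1_{p-1,q}$ (for $p\ge1$) is the map $(\varrho^{p+1}_q)_*\colon H_q(W^{p+1}(f))\to H_q(W^{p}(f))$ induced by $\varrho^{p+1}_q$. 2. The second spectral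 sequence of the alternating double complex (the Image-Computing Spectral Sequence) is a first quadrant spectral sequence with $$E^1_{p,q}\cong AH_q(D^{p+1}(f))\Longrightarrow H_{p+q}(Y).$$ Under these isomorphisms the differential $d^1\colon E^1_{p,q}\to E^1_{p-1,q}$ (for $p\ge1$) is the map $(\epsilon^{p+1}_q)_*\colon AH_q(D^{p+1}(f))\to AH_q(D^{p}(f))$ induced by $\epsilon^{p+1}_q$. -/

import Mathlib

open CategoryTheory

namespace MultiplePoint

section SimplicialChains

open Geometry

variable (R : Type) [CommRing R] {V V' V'' : Type} [AddCommGroup V] [Module ℝ V]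
  [AddCommGroup V'] [Module ℝ V'] [AddCommGroup V''] [Module ℝ V'']

/-- The sign of a permutation, as a scalar. -/
def sgn {k : ℕ} (σ : Equiv.Perm (Fin k)) : R := ((Equiv.Perm.sign σ : ℤ) : R)

lemma sgn_mul_self {k : ℕ} (σ : Equiv.Perm (Fin k)) : sgn R σ * sgn R σ = 1 := by
  rw [sgn, ← Int.cast_mul, ← Units.val_mul, Int.units_mul_self]; simp

/-- An ordered `n`-simplex `[v_0, …, v_n]` of `K`: an ordering of the (distinct) vertices of a
simplex of `K`. -/
def OrderedSimplex (K : SimplicialComplex ℝ V) (n : ℕ) : Type :=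
  {v : Fin (n + 1) → V // Function.Injective v ∧ ∃ s ∈ K.faces, (s : Set V) = Set.range v}

namespace OrderedSimplex

variable {K : SimplicialComplex ℝ V} {n : ℕ}

/-- The same simplex with its vertices reordered. -/
def perm (v : OrderedSimplex K n) (τ : Equiv.Perm (Fin (n + 1))) : OrderedSimplex K n :=
  ⟨v.1 ∘ τ, v.2.1.comp τ.injective, by
    obtain ⟨s, hs, h⟩ := v.2.2
    exact ⟨s, hs, by rw [h, Set.range_comp, τ.surjective.range_eq, Set.image_univ]⟩⟩

/-- The face obtained by restriction of the vertices along an injection. -/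
def restrict {m : ℕ} (v : OrderedSimplex K n) (φ : Fin (m + 1) → Fin (n + 1))
    (hφ : Function.Injective φ) : OrderedSimplex K m :=
  ⟨v.1 ∘ φ, v.2.1.comp hφ, by
    classical
    obtain ⟨s, hs, h⟩ := v.2.2
    refine ⟨Finset.univ.image (v.1 ∘ φ), K.down_closed hs ?_ ⟨v.1 (φ 0), ?_⟩, by simp [Function.comp_def]⟩
    · intro x hx
      obtain ⟨i, -, rfl⟩ := Finset.mem_image.1 hx
      rw [← Finset.mem_coe, h]
      exact ⟨φ i, rfl⟩
    · exact Finset.mem_image.2 ⟨0, Finset.mem_univ _, rfl⟩⟩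

/-- The face opposite to the `i`-th vertex. -/
def face (v : OrderedSimplex K (n + 1)) (i : Fin (n + 2)) : OrderedSimplex K n :=
  v.restrict i.succAbove Fin.succAbove_right_injective

end OrderedSimplex

/-- The relations `[v_{τ 0}, …, v_{τ n}] = sign(τ) [v_0, …, v_n]`. -/
noncomputable def orientationRelations (K : SimplicialComplex ℝ V) (n : ℕ) :
    Submodule R (OrderedSimplex K n →₀ R) :=
  Submodule.span R (Set.range fun x : OrderedSimplex K n × Equiv.Perm (Fin (n + 1)) =>
    Finsupp.single (x.1.perm x.2) 1 - sgn R x.2 • Finsupp.single x.1 1)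

/-- The module `C_n(K)` of (oriented) simplicial `n`-chains: it is generated by the ordered
`n`-simplices, and an odd reordering of the vertices changes the sign. -/
abbrev Chain (K : SimplicialComplex ℝ V) (n : ℕ) : Type :=
  (OrderedSimplex K n →₀ R) ⧸ orientationRelations R K n

namespace Chain

variable {K : SimplicialComplex ℝ V} {K' : SimplicialComplex ℝ V'} {K'' : SimplicialComplex ℝ V''}
  {n : ℕ}

/-- The chain given by an ordered simplex. -/
noncomputable def of (v : OrderedSimplex K n) : Chain R K n :=
  Submodule.Quotient.mk (Finsupp.single v 1)

lemma of_perm (v : OrderedSimplex K n) (τ : Equiv.Perm (Fin (n + 1))) :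
    of R (v.perm τ) = sgn R τ • of R v := by
  rw [of, of, ← Submodule.Quotient.mk_smul]
  exact (Submodule.Quotient.eq _).2 (Submodule.subset_span ⟨(v, τ), rfl⟩)

variable {R}

/-- A linear map defined on chains is determined by its values on ordered simplices, which may be
prescribed arbitrarily subject to compatibility with the change of orientation. -/
noncomputable def lift {M : Type} [AddCommGroup M] [Module R M] (φ : OrderedSimplex K n → M)
    (hφ : ∀ v τ, φ (v.perm τ) = sgn R τ • φ v) : Chain R K n →ₗ[R] M :=
  Submodule.liftQ _ (Finsupp.linearCombination R φ) <| Submodule.span_le.2 <| by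
    rintro _ ⟨⟨v, τ⟩, rfl⟩
    simp [hφ]

@[simp]
lemma lift_of {M : Type} [AddCommGroup M] [Module R M] (φ : OrderedSimplex K n → M)
    (hφ : ∀ v τ, φ (v.perm τ) = sgn R τ • φ v) (v : OrderedSimplex K n) :
    lift φ hφ (of R v) = φ v := by
  rw [lift, of]
  exact (Submodule.liftQ_apply _ _ _).trans (by simp)

lemma hom_ext {M : Type} [AddCommGroup M] [Module R M] {φ ψ : Chain R K n →ₗ[R] M}
    (h : ∀ v, φ (of R v) = ψ (of R v)) : φ = ψ := by
  refine Submodule.linearMap_qext _ (Finsupp.lhom_ext' fun v => LinearMap.ext_ring ?_)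
  exact h v

end Chain

/-- Reordering the vertices of a simplex reorders those of each facet, with the expected sign. -/
lemma exists_perm_succAbove {n : ℕ} (τ : Equiv.Perm (Fin (n + 2))) (i : Fin (n + 2)) :
    ∃ σ : Equiv.Perm (Fin (n + 1)), (∀ j, τ (i.succAbove j) = (τ i).succAbove (σ j)) ∧
      (-1 : R) ^ (i : ℕ) * sgn R σ = sgn R τ * (-1 : R) ^ (τ i : ℕ) := by
  obtain ⟨⟨p, σ⟩, hp⟩ := Equiv.Perm.decomposeFin.symm.surjective
    ((τ i).cycleRange * τ * i.cycleRange⁻¹)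
  have hp0 : p = 0 := by
    have := congrArg (fun e : Equiv.Perm (Fin (n + 2)) => e 0) hp
    rw [Equiv.Perm.decomposeFin_symm_apply_zero] at this
    rw [this]
    simp [Equiv.Perm.mul_apply, Equiv.Perm.inv_def]
  subst hp0
  refine ⟨σ, fun j => ?_, ?_⟩
  · have := congrArg (fun e : Equiv.Perm (Fin (n + 2)) => e j.succ) hp
    simp only [Equiv.Perm.mul_apply, Equiv.Perm.inv_def, Fin.cycleRange_symm_succ,
      Equiv.Perm.decomposeFin_symm_apply_succ, Equiv.swap_self, Equiv.refl_apply] at this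
    rw [← Fin.cycleRange_symm_succ (τ i), this, Equiv.symm_apply_apply]
  · have := congrArg (fun e => sgn R e) hp
    simp only [sgn, Equiv.Perm.decomposeFin.symm_sign, if_true, one_mul, Equiv.Perm.sign_mul,
      Equiv.Perm.sign_inv, Fin.sign_cycleRange] at this ⊢
    rw [this]
    push_cast
    have h2 : ((-1 : R) ^ (i : ℕ)) * (-1) ^ (i : ℕ) = 1 := by rw [← mul_pow]; simp
    linear_combination ((-1 : R) ^ (τ i : ℕ) * ((Equiv.Perm.sign τ : ℤ) : R)) * h2

/-- The cancellation behind `∂ ∘ ∂ = 0`. -/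
lemma sum_succAbove_succAbove {M : Type} [AddCommGroup M] [Module R M] (n : ℕ)
    (g : (Fin n → Fin (n + 2)) → M) :
    ∑ i : Fin (n + 2), ∑ j : Fin (n + 1),
      (-1 : R) ^ (i : ℕ) • (-1 : R) ^ (j : ℕ) • g (i.succAbove ∘ j.succAbove) = 0 := by
  rw [← Finset.sum_product' Finset.univ Finset.univ fun (i : Fin (n + 2)) (j : Fin (n + 1)) =>
      (-1 : R) ^ (i : ℕ) • (-1 : R) ^ (j : ℕ) • g (i.succAbove ∘ j.succAbove)]
  refine Finset.sum_involution (fun x _ => (x.1.succAbove x.2, x.2.predAbove x.1)) ?_ ?_ ?_ ?_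
  · rintro ⟨i, j⟩ -
    have h1 : (i.succAbove j).succAbove ∘ (j.predAbove i).succAbove =
        i.succAbove ∘ j.succAbove :=
      funext fun k => Fin.succAbove_succAbove_succAbove_predAbove i j k
    rw [h1, smul_smul, smul_smul, ← add_smul]
    suffices h : (-1 : R) ^ (i : ℕ) * (-1) ^ (j : ℕ) +
        (-1) ^ (i.succAbove j : ℕ) * (-1) ^ (j.predAbove i : ℕ) = 0 by rw [h, zero_smul]
    rcases lt_or_ge j.castSucc i with hij | hij
    · rw [Fin.succAbove_of_castSucc_lt _ _ hij, Fin.predAbove_of_castSucc_lt _ _ hij]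
      obtain ⟨m, hm⟩ : ∃ m, (i : ℕ) = m + 1 := ⟨i - 1, by have := Fin.lt_def.1 hij; lia⟩
      simp [hm, pow_succ, mul_comm]
    · rw [Fin.succAbove_of_le_castSucc _ _ hij, Fin.predAbove_of_le_castSucc _ _ hij]
      simp [pow_succ, mul_comm]
  · rintro ⟨i, j⟩ - - h
    exact Fin.succAbove_ne i j (congrArg Prod.fst h)
  · intro x _
    exact Finset.mem_product.2 ⟨Finset.mem_univ _, Finset.mem_univ _⟩
  · rintro ⟨i, j⟩ -
    exact Prod.ext (Fin.succAbove_succAbove_predAbove i j)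
      (Fin.predAbove_predAbove_succAbove i j)

namespace Chain

variable {R} {K : SimplicialComplex ℝ V} {K' : SimplicialComplex ℝ V'}
  {K'' : SimplicialComplex ℝ V''} {n : ℕ}

/-- The boundary map `∂[v_0, …, v_{n+1}] = ∑ (-1)^i [v_0, …, v̂_i, …, v_{n+1}]`. -/
noncomputable def boundary (K : SimplicialComplex ℝ V) (n : ℕ) :
    Chain R K (n + 1) →ₗ[R] Chain R K n :=
  lift (fun v => ∑ i : Fin (n + 2), (-1 : R) ^ (i : ℕ) • of R (v.face i)) fun v τ => by
    rw [Finset.smul_sum, ← Equiv.sum_comp τ fun i => sgn R τ • (-1 : R) ^ (i : ℕ) • of R (v.face i)]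
    refine Finset.sum_congr rfl fun i _ => ?_
    obtain ⟨σ, h1, h2⟩ := exists_perm_succAbove R τ i
    have : (v.perm τ).face i = (v.face (τ i)).perm σ :=
      Subtype.ext (funext fun j => congrArg v.1 (h1 j))
    rw [this, of_perm, smul_smul, smul_smul, h2]

lemma boundary_of (v : OrderedSimplex K (n + 1)) :
    boundary K n (of R v) = ∑ i : Fin (n + 2), (-1 : R) ^ (i : ℕ) • of R (v.face i) :=
  lift_of _ _ _

lemma boundary_boundary (c : Chain R K (n + 2)) : boundary K n (boundary K (n + 1) c) = 0 := by
  classical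
  suffices h : (boundary K n).comp (boundary K (n + 1)) = (0 : Chain R K (n + 2) →ₗ[R] _) from
    LinearMap.congr_fun h c
  refine hom_ext fun v => ?_
  rw [LinearMap.comp_apply, boundary_of, map_sum, LinearMap.zero_apply,
    ← sum_succAbove_succAbove R (n + 1) fun φ => if h : Function.Injective φ then
      of R (v.restrict φ h) else 0]
  refine Finset.sum_congr rfl fun i _ => ?_
  rw [map_smul, boundary_of, Finset.smul_sum]
  refine Finset.sum_congr rfl fun j _ => ?_
  rw [dif_pos (Fin.succAbove_right_injective.comp Fin.succAbove_right_injective)]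
  rfl

end Chain

/-- A simplicial map which is injective on each simplex. -/
def IsNondegenerateSimplicial (K : SimplicialComplex ℝ V) (K' : SimplicialComplex ℝ V')
    (g : V → V') : Prop :=
  ∀ s ∈ K.faces, Set.InjOn g s ∧ ∃ t ∈ K'.faces, (t : Set V') = g '' s

namespace Chain

variable {R} {K : SimplicialComplex ℝ V} {K' : SimplicialComplex ℝ V'}
  {K'' : SimplicialComplex ℝ V''} {n : ℕ}

/-- The image of an ordered simplex under a nondegenerate simplicial map. -/
def mapSimplex {g : V → V'} (hg : IsNondegenerateSimplicial K K' g) (v : OrderedSimplex K n) :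
    OrderedSimplex K' n :=
  ⟨g ∘ v.1, by
    obtain ⟨s, hs, h⟩ := v.2.2
    refine fun i j hij => v.2.1 ((hg s hs).1 ?_ ?_ hij)
    · rw [h]; exact ⟨i, rfl⟩
    · rw [h]; exact ⟨j, rfl⟩, by
    obtain ⟨s, hs, h⟩ := v.2.2
    obtain ⟨t, ht, h'⟩ := (hg s hs).2
    exact ⟨t, ht, by rw [h', h, Set.range_comp]⟩⟩

/-- The map `g_#` induced on chains by a nondegenerate simplicial map `g`. -/
noncomputable def map {g : V → V'} (hg : IsNondegenerateSimplicial K K' g) (n : ℕ) :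
    Chain R K n →ₗ[R] Chain R K' n :=
  lift (fun v => of R (mapSimplex hg v)) fun v τ => by rw [← of_perm]; rfl

lemma map_of {g : V → V'} (hg : IsNondegenerateSimplicial K K' g) (v : OrderedSimplex K n) :
    map hg n (of R v) = of R (mapSimplex hg v) := lift_of _ _ _

lemma boundary_map {g : V → V'} (hg : IsNondegenerateSimplicial K K' g) (c : Chain R K (n + 1)) :
    boundary K' n (map hg (n + 1) c) = map hg n (boundary K n c) := by
  suffices h : (boundary K' n).comp (map hg (n + 1)) =
      (map hg n).comp (boundary (R := R) K n) from LinearMap.congr_fun h c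
  refine hom_ext fun v => ?_
  rw [LinearMap.comp_apply, LinearMap.comp_apply, map_of, boundary_of, boundary_of, map_sum]
  refine Finset.sum_congr rfl fun i _ => ?_
  rw [map_smul, map_of]
  rfl

lemma map_map {g : V → V'} (hg : IsNondegenerateSimplicial K K' g) {g' : V' → V''}
    (hg' : IsNondegenerateSimplicial K' K'' g') {g'' : V → V''}
    (hg'' : IsNondegenerateSimplicial K K'' g'') (h : ∀ x, g' (g x) = g'' x) (c : Chain R K n) :
    map hg' n (map hg n c) = map hg'' n c := by
  suffices h : (map hg' n).comp (map hg n) = (map hg'' n : Chain R K n →ₗ[R] _) from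
    LinearMap.congr_fun h c
  refine hom_ext fun v => ?_
  rw [LinearMap.comp_apply, map_of, map_of, map_of]
  exact congrArg _ (Subtype.ext (funext fun i => h _))

/-- Two orderings of the same simplex differ by a permutation. -/
lemma exists_perm (v w : OrderedSimplex K n) (h : Set.range v.1 = Set.range w.1) :
    ∃ τ : Equiv.Perm (Fin (n + 1)), v = w.perm τ := by
  refine ⟨(Equiv.ofInjective _ v.2.1).trans
    ((Equiv.setCongr h).trans (Equiv.ofInjective _ w.2.1).symm), Subtype.ext (funext fun i => ?_)⟩
  have := congrArg Subtype.val ((Equiv.ofInjective _ w.2.1).apply_symm_apply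
    (Equiv.setCongr h (Equiv.ofInjective _ v.2.1 i)))
  exact this.symm

/-- The chains `C_n(K)` form a free module: choosing an orientation of each simplex identifies
them with the finitely supported functions on the set of `n`-simplices. -/
lemma exists_injective_finsupp (K : SimplicialComplex ℝ V) (n : ℕ) :
    ∃ φ : Chain R K n →ₗ[R] (Set V →₀ R), Function.Injective φ := by
  classical
  have h1 : ∀ s : Set V, ∃ w : Option (OrderedSimplex K n),
      ∀ v : OrderedSimplex K n, Set.range v.1 = s → ∃ u, w = some u ∧ Set.range u.1 = s := by
    intro s
    by_cases h : ∃ v : OrderedSimplex K n, Set.range v.1 = s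
    · obtain ⟨v, hv⟩ := h
      exact ⟨some v, fun _ _ => ⟨v, rfl, hv⟩⟩
    · exact ⟨none, fun v hv => (h ⟨v, hv⟩).elim⟩
  choose w hw using h1
  have h2 : ∀ v : OrderedSimplex K n, ∃ u τ, w (Set.range v.1) = some u ∧ v = u.perm τ := by
    intro v
    obtain ⟨u, hu, hu'⟩ := hw _ v rfl
    obtain ⟨τ, hτ⟩ := exists_perm v u hu'.symm
    exact ⟨u, τ, hu, hτ⟩
  choose u τ hu hτ using h2
  have hrange : ∀ (v : OrderedSimplex K n) (ρ : Equiv.Perm (Fin (n + 1))),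
      Set.range (v.perm ρ).1 = Set.range v.1 := fun v ρ => by
    change Set.range (v.1 ∘ ρ) = _
    rw [Set.range_comp, ρ.surjective.range_eq, Set.image_univ]
  have hτρ : ∀ v ρ, sgn R (τ (v.perm ρ)) = sgn R ρ * sgn R (τ v) := by
    intro v ρ
    have e : u (v.perm ρ) = u v := by
      have := hu (v.perm ρ)
      rw [hrange, hu v] at this
      exact (Option.some.inj this).symm
    have : τ (v.perm ρ) = τ v * ρ := by
      refine Equiv.ext fun i => (u v).2.1 ?_
      have a1 := congrFun (congrArg Subtype.val (hτ (v.perm ρ))) i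
      have a2 := congrFun (congrArg Subtype.val (hτ v)) (ρ i)
      rw [e] at a1
      exact a1.symm.trans a2
    rw [this, sgn, sgn, sgn, Equiv.Perm.sign_mul]
    push_cast
    ring
  let φ : Chain R K n →ₗ[R] (Set V →₀ R) :=
    lift (fun v => sgn R (τ v) • Finsupp.single (Set.range v.1) 1) fun v ρ => by
      rw [hτρ, hrange, smul_smul]
  let ψ : (Set V →₀ R) →ₗ[R] Chain R K n :=
    Finsupp.linearCombination R fun s => (w s).elim 0 (of R)
  have hψφ : ψ.comp φ = LinearMap.id := by
    refine hom_ext fun v => ?_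
    simp only [φ, ψ, LinearMap.comp_apply, lift_of, map_smul, Finsupp.linearCombination_single,
      hu v, Option.elim_some, LinearMap.id_apply, one_smul]
    conv_rhs => rw [hτ v, of_perm]
  exact ⟨φ, Function.LeftInverse.injective (g := ψ) fun c => LinearMap.congr_fun hψφ c⟩

lemma eq_zero_of_eq_neg [IsDomain R] [CharZero R] {c : Chain R K n} (h : c = -c) : c = 0 := by
  obtain ⟨φ, hφ⟩ := exists_injective_finsupp (R := R) K n
  refine hφ ?_
  rw [map_zero]
  ext s
  have := congrArg (fun c => φ c s) h
  simp only [map_neg, Finsupp.neg_apply] at this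
  exact self_eq_neg.1 this

end Chain

/-- The simplicial chain complex of a geometric simplicial complex. -/
noncomputable def simplicialChainComplex (K : SimplicialComplex ℝ V) :
    ChainComplex (ModuleCat.{0} R) ℕ :=
  ChainComplex.of (fun n => ModuleCat.of R (Chain R K n))
    (fun n => ModuleCat.ofHom (Chain.boundary K n)) fun n => by
      rw [← ModuleCat.ofHom_comp]
      exact congrArg ModuleCat.ofHom (LinearMap.ext Chain.boundary_boundary)

lemma simplicialChainComplex_d (K : SimplicialComplex ℝ V) (n : ℕ) :
    (simplicialChainComplex R K).d (n + 1) n = ModuleCat.ofHom (Chain.boundary K n) :=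
  ChainComplex.of_d (fun n => ModuleCat.of R (Chain R K n))
    (fun n => ModuleCat.ofHom (Chain.boundary K n)) n

end SimplicialChains

end MultiplePoint

namespace MultiplePoint

section SpectralSequences

variable {R : Type} [CommRing R]

/-! ### Spectral sequences -/

/-- A graded module with a differential of degree `-1` and an increasing filtration by
subcomplexes. -/
structure FilteredComplex (R : Type) [CommRing R] where
  /-- the direct sum of all the degrees -/
  T : ModuleCat.{0} R
  /-- the differential -/
  D : T →ₗ[R] T
  D_D : ∀ x, D (D x) = 0
  /-- `F p n` is the `p`-th stage of the filtration of the degree `n` part -/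
  F : ℤ → ℤ → Submodule R T
  F_mono : ∀ {p p' : ℤ} (n : ℤ), p ≤ p' → F p n ≤ F p' n
  D_mem : ∀ {p n : ℤ} {x : T}, x ∈ F p n → D x ∈ F p (n - 1)

namespace FilteredComplex

variable (A : FilteredComplex R)

/-- `Z^r_p` in degree `n`: the elements of `F_p` whose differential lies in `F_{p-r}`. -/
def Z (r p n : ℤ) : Submodule R A.T := A.F p n ⊓ (A.F (p - r) (n - 1)).comap A.D

/-- `Z^{r-1}_{p-1} + D Z^{r-1}_{p+r-1}` in degree `n`. -/
def B (r p n : ℤ) : Submodule R A.T :=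
  A.Z (r - 1) (p - 1) n ⊔ (A.Z (r - 1) (p + r - 1) (n + 1)).map A.D

/-- `E^r_{p,q} = Z^r_p / (Z^{r-1}_{p-1} + D Z^{r-1}_{p+r-1})` in degree `p + q`. -/
abbrev E (r : ℤ) (i : ℤ × ℤ) : Type :=
  A.Z r i.1 (i.1 + i.2) ⧸ (A.B r i.1 (i.1 + i.2)).submoduleOf (A.Z r i.1 (i.1 + i.2))

variable {A}

lemma mem_Z {r p n : ℤ} {x : A.T} :
    x ∈ A.Z r p n ↔ x ∈ A.F p n ∧ A.D x ∈ A.F (p - r) (n - 1) := Iff.rfl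

lemma mem_B {r p n : ℤ} {x : A.T} :
    x ∈ A.B r p n ↔ ∃ a ∈ A.Z (r - 1) (p - 1) n, ∃ b ∈ A.Z (r - 1) (p + r - 1) (n + 1),
      a + A.D b = x := by
  simp only [B, Submodule.mem_sup, Submodule.mem_map]
  constructor
  · rintro ⟨a, ha, _, ⟨b, hb, rfl⟩, rfl⟩
    exact ⟨a, ha, b, hb, rfl⟩
  · rintro ⟨a, ha, b, hb, rfl⟩
    exact ⟨a, ha, _, ⟨b, hb, rfl⟩, rfl⟩

lemma D_mem_Z {r : ℤ} {i j : ℤ × ℤ} (h : i + (-r, r - 1) = j) {x : A.T}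
    (hx : x ∈ A.Z r i.1 (i.1 + i.2)) : A.D x ∈ A.Z r j.1 (j.1 + j.2) := by
  subst h
  rw [mem_Z] at hx ⊢
  simp only [Prod.fst_add, Prod.snd_add, A.D_D]
  refine ⟨?_, Submodule.zero_mem _⟩
  convert hx.2 using 2 <;> ring

lemma D_mem_B {r : ℤ} {i j : ℤ × ℤ} (h : i + (-r, r - 1) = j) {x : A.T}
    (hx : x ∈ A.B r i.1 (i.1 + i.2)) : A.D x ∈ A.B r j.1 (j.1 + j.2) := by
  subst h
  obtain ⟨a, ha, b, hb, rfl⟩ := mem_B.1 hx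
  refine mem_B.2 ⟨0, Submodule.zero_mem _, a, ?_, by simp [A.D_D]⟩
  simp only [Prod.fst_add, Prod.snd_add]
  convert ha using 1
  congr 1 <;> ring

variable (A) in
/-- The differential `d^r : E^r_{p,q} → E^r_{p-r,q+r-1}`, induced by `D`. -/
noncomputable def d (r : ℤ) {i j : ℤ × ℤ} (h : i + (-r, r - 1) = j) : A.E r i →ₗ[R] A.E r j :=
  Submodule.mapQ _ _ (A.D.restrict fun _ hx => D_mem_Z h hx) fun _ hx => D_mem_B h hx

lemma d_mk (r : ℤ) {i j : ℤ × ℤ} (h : i + (-r, r - 1) = j) (x : A.Z r i.1 (i.1 + i.2)) :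
    A.d r h (Submodule.Quotient.mk x) = Submodule.Quotient.mk ⟨A.D x, D_mem_Z h x.2⟩ := rfl

lemma mk_eq_mk {r : ℤ} {i : ℤ × ℤ} (x y : A.Z r i.1 (i.1 + i.2)) :
    (Submodule.Quotient.mk x : A.E r i) = Submodule.Quotient.mk y ↔
      (x : A.T) - y ∈ A.B r i.1 (i.1 + i.2) := Submodule.Quotient.eq _

lemma mk_eq_zero {r : ℤ} {i : ℤ × ℤ} (x : A.Z r i.1 (i.1 + i.2)) :
    (Submodule.Quotient.mk x : A.E r i) = 0 ↔ (x : A.T) ∈ A.B r i.1 (i.1 + i.2) :=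
  Submodule.Quotient.mk_eq_zero _

lemma d_d (r : ℤ) {i j k : ℤ × ℤ} (h : i + (-r, r - 1) = j) (h' : j + (-r, r - 1) = k)
    (x : A.E r i) : A.d r h' (A.d r h x) = 0 := by
  obtain ⟨x, rfl⟩ := Submodule.Quotient.mk_surjective _ x
  rw [d_mk, d_mk, mk_eq_zero]
  change A.D (A.D x) ∈ _
  rw [A.D_D]
  exact Submodule.zero_mem _

lemma d_comp_d (r : ℤ) {i j k : ℤ × ℤ} (h : i + (-r, r - 1) = j) (h' : j + (-r, r - 1) = k) :
    ModuleCat.ofHom (A.d r h) ≫ ModuleCat.ofHom (A.d r h') = 0 := by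
  rw [← ModuleCat.ofHom_comp]
  exact congrArg ModuleCat.ofHom (LinearMap.ext (d_d r h h'))

variable (A) in
open Classical in
/-- The `r`-th page of the spectral sequence of a filtered complex. -/
noncomputable def page (r : ℤ) :
    HomologicalComplex (ModuleCat.{0} R) (ComplexShape.up' ((-r, r - 1) : ℤ × ℤ)) where
  X i := ModuleCat.of R (A.E r i)
  d i j := if h : i + (-r, r - 1) = j then ModuleCat.ofHom (A.d r h) else 0
  shape i j h := dif_neg h
  d_comp_d' i j k h h' := by
    have e : ∀ {i j : ℤ × ℤ} (h : i + (-r, r - 1) = j), (if h : i + (-r, r - 1) = j then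
        ModuleCat.ofHom (A.d r h) else 0) = ModuleCat.ofHom (A.d r h) := fun h => dif_pos h
    rw [e h, e h']
    exact d_comp_d r h h'

lemma page_d (r : ℤ) {i j : ℤ × ℤ} (h : i + (-r, r - 1) = j) :
    (A.page r).d i j = ModuleCat.ofHom (A.d r h) := dif_pos h

lemma Z_succ_le (r p n : ℤ) : A.Z (r + 1) p n ≤ A.Z r p n := fun _ hx =>
  ⟨hx.1, A.F_mono _ (by lia) hx.2⟩

lemma d_mk_eq_zero {r : ℤ} {i j : ℤ × ℤ} (h : i + (-r, r - 1) = j)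
    (x : A.Z r i.1 (i.1 + i.2)) :
    A.d r h (Submodule.Quotient.mk x) = 0 ↔
      ∃ y ∈ A.Z (r + 1) i.1 (i.1 + i.2), (x : A.T) - y ∈ A.B r i.1 (i.1 + i.2) := by
  subst h
  rw [d_mk, mk_eq_zero]
  constructor
  · intro hx
    obtain ⟨a, ha, b, hb, hab⟩ := mem_B.1 hx
    have hab : a + A.D b = A.D x := hab
    simp only [Prod.fst_add, Prod.snd_add] at ha hb
    have hb' : b ∈ A.Z (r - 1) (i.1 - 1) (i.1 + i.2) := by
      convert hb using 2 <;> ring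
    refine ⟨x - b, mem_Z.2 ⟨Submodule.sub_mem _ x.2.1 (A.F_mono _ (by lia) hb'.1), ?_⟩,
      mem_B.2 ⟨b, hb', 0, Submodule.zero_mem _, by simp⟩⟩
    have : A.D (x - b) = a := by rw [map_sub, ← hab]; abel
    rw [this]
    have h1 := (mem_Z.1 ha).1
    rwa [show i.1 + -r - 1 = i.1 - (r + 1) by ring,
      show i.1 + -r + (i.2 + (r - 1)) = i.1 + i.2 - 1 by ring] at h1
  · rintro ⟨y, hy, hxy⟩
    have h1 : A.D ((x : A.T) - y) ∈ _ := D_mem_B (A := A) (r := r) (i := i) rfl hxy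
    have h2 : A.D y ∈ A.B r (i.1 + -r) (i.1 + -r + (i.2 + (r - 1))) := by
      refine mem_B.2 ⟨A.D y, mem_Z.2 ⟨?_, ?_⟩, 0, Submodule.zero_mem _, by simp⟩
      · have := hy.2
        rwa [show i.1 - (r + 1) = i.1 + -r - 1 by ring,
          show i.1 + i.2 - 1 = i.1 + -r + (i.2 + (r - 1)) by ring] at this
      · rw [A.D_D]
        exact Submodule.zero_mem _
    have h3 := Submodule.add_mem _ h1 h2
    rw [← map_add, sub_add_cancel] at h3
    exact h3

/-- The elements of `B^{r+1}` are those elements of `Z^{r+1}` whose class in `E^r` is a boundary. -/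
lemma mem_B_succ {r : ℤ} {i j : ℤ × ℤ} (h : i + (-r, r - 1) = j) {x : A.T}
    (hx : x ∈ A.Z (r + 1) j.1 (j.1 + j.2)) :
    x ∈ A.B (r + 1) j.1 (j.1 + j.2) ↔
      ∃ y ∈ A.Z r i.1 (i.1 + i.2), x - A.D y ∈ A.B r j.1 (j.1 + j.2) := by
  obtain ⟨j1, j2⟩ := j
  have hi : i = (j1 + r, j2 - r + 1) := by
    rw [Prod.ext_iff] at h ⊢; simp at h ⊢; lia
  subst hi
  have e1 : j1 + r + (j2 - r + 1) = j1 + j2 + 1 := by ring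
  have e2 : j1 + (r + 1) - 1 = j1 + r := by ring
  simp only [e1] at hx ⊢
  constructor
  · intro hx'
    obtain ⟨a, ha, b, hb, rfl⟩ := mem_B.1 hx'
    simp only [add_sub_cancel_right, e2] at ha hb
    refine ⟨b, hb, mem_B.2 ⟨a, ⟨ha.1, ?_⟩, 0, Submodule.zero_mem _, by simp⟩⟩
    have := hx.2
    replace this : A.D (a + A.D b) ∈ A.F _ _ := this
    rw [map_add, A.D_D, add_zero] at this
    exact A.F_mono _ (by lia) this
  · rintro ⟨y, hy, hxy⟩
    obtain ⟨a, ha, b, hb, hab⟩ := mem_B.1 hxy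
    have hx2 : a + A.D (b + y) = x := by rw [map_add, ← add_assoc, hab]; abel
    have hb2 : b ∈ A.Z r (j1 + r) (j1 + j2 + 1) :=
      ⟨A.F_mono _ (by lia) hb.1, A.F_mono _ (by lia) hb.2⟩
    refine mem_B.2 ⟨a, ?_, b + y, ?_, hx2⟩
    · simp only [add_sub_cancel_right]
      refine ⟨ha.1, ?_⟩
      have := hx.2
      rw [← hx2] at this
      replace this : A.D (a + A.D (b + y)) ∈ A.F _ _ := this
      rw [map_add, A.D_D, add_zero] at this
      exact A.F_mono _ (by lia) this
    · simp only [add_sub_cancel_right, e2]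
      exact Submodule.add_mem _ hb2 hy

/-- The map `Z^{r+1} → ker d^r / im d^r` sending an element to its class. -/
noncomputable def toHomology (r : ℤ) {i j k : ℤ × ℤ} (h : i + (-r, r - 1) = j)
    (h' : j + (-r, r - 1) = k) :
    A.Z (r + 1) j.1 (j.1 + j.2) →ₗ[R]
      (LinearMap.ker (A.d r h') ⧸ (LinearMap.range (A.d r h)).submoduleOf
        (LinearMap.ker (A.d r h'))) :=
  (Submodule.mkQ _).comp <|
    ((Submodule.mkQ _).comp (Submodule.inclusion (Z_succ_le r _ _))).codRestrict _ fun x => by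
      rw [LinearMap.mem_ker]
      exact (d_mk_eq_zero h' _).2 ⟨x, x.2, by simp⟩

lemma toHomology_surjective (r : ℤ) {i j k : ℤ × ℤ} (h : i + (-r, r - 1) = j)
    (h' : j + (-r, r - 1) = k) : Function.Surjective (A.toHomology r h h') := by
  intro x
  obtain ⟨⟨x, hx⟩, rfl⟩ := Submodule.Quotient.mk_surjective _ x
  obtain ⟨x, rfl⟩ := Submodule.Quotient.mk_surjective _ x
  obtain ⟨y, hy, hxy⟩ := (d_mk_eq_zero h' x).1 hx
  refine ⟨⟨y, hy⟩, ?_⟩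
  refine congrArg Submodule.Quotient.mk (Subtype.ext ?_)
  exact ((mk_eq_mk x ⟨y, Z_succ_le _ _ _ hy⟩).2 hxy).symm

lemma ker_toHomology (r : ℤ) {i j k : ℤ × ℤ} (h : i + (-r, r - 1) = j)
    (h' : j + (-r, r - 1) = k) :
    LinearMap.ker (A.toHomology r h h') =
      (A.B (r + 1) j.1 (j.1 + j.2)).submoduleOf (A.Z (r + 1) j.1 (j.1 + j.2)) := by
  ext ⟨x, hx⟩
  rw [LinearMap.mem_ker]
  refine (Submodule.Quotient.mk_eq_zero _).trans (Iff.trans ?_ (mem_B_succ h hx).symm)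
  constructor
  · rintro ⟨y, hy⟩
    obtain ⟨y, rfl⟩ := Submodule.Quotient.mk_surjective _ y
    exact ⟨y, y.2, (mk_eq_mk ⟨x, Z_succ_le _ _ _ hx⟩ ⟨A.D y, D_mem_Z h y.2⟩).1 hy.symm⟩
  · rintro ⟨y, hy, hxy⟩
    exact ⟨Submodule.Quotient.mk ⟨y, hy⟩,
      ((mk_eq_mk ⟨x, Z_succ_le _ _ _ hx⟩ ⟨A.D y, D_mem_Z h hy⟩).2 hxy).symm⟩

/-- The isomorphism `E^{r+1} ≅ ker d^r / im d^r` induced by the identity on representatives. -/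
noncomputable def homologyEquiv (r : ℤ) {i j k : ℤ × ℤ} (h : i + (-r, r - 1) = j)
    (h' : j + (-r, r - 1) = k) :
    A.E (r + 1) j ≃ₗ[R]
      (LinearMap.ker (A.d r h') ⧸ (LinearMap.range (A.d r h)).submoduleOf
        (LinearMap.ker (A.d r h'))) :=
  (Submodule.quotEquivOfEq _ _ (ker_toHomology r h h').symm).trans
    ((A.toHomology r h h').quotKerEquivOfSurjective (toHomology_surjective r h h'))

variable (A) in
/-- The short complex `E^r → E^r → E^r` formed by two consecutive differentials. -/
noncomputable abbrev pageSc (r : ℤ) {i j k : ℤ × ℤ} (h : i + (-r, r - 1) = j)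
    (h' : j + (-r, r - 1) = k) : ShortComplex (ModuleCat.{0} R) :=
  ShortComplex.mk (ModuleCat.ofHom (A.d r h)) (ModuleCat.ofHom (A.d r h')) (d_comp_d r h h')

variable (A) in
/-- The comparison with the short complex used to define the homology of a page. -/
noncomputable def pageScIso (r : ℤ) {i j k : ℤ × ℤ} (h : i + (-r, r - 1) = j)
    (h' : j + (-r, r - 1) = k) : (A.page r).sc' i j k ≅ A.pageSc r h h' :=
  ShortComplex.isoMk (Iso.refl _) (Iso.refl _) (Iso.refl _)
    ((Category.id_comp _).trans ((page_d r h).symm.trans (Category.comp_id _).symm))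
    ((Category.id_comp _).trans ((page_d r h').symm.trans (Category.comp_id _).symm))

/-- The explicit description of the homology of a page. -/
noncomputable def pageHomologyIso (r : ℤ) {i j k : ℤ × ℤ} (h : i + (-r, r - 1) = j)
    (h' : j + (-r, r - 1) = k) :
    (A.page r).homology j ≅ ModuleCat.of R
      (LinearMap.ker (A.d r h') ⧸ (LinearMap.range (A.d r h)).submoduleOf
        (LinearMap.ker (A.d r h'))) :=
  (A.page r).homologyIsoSc' i j k (ComplexShape.prev_eq' _ h) (ComplexShape.next_eq' _ h') ≪≫
    ShortComplex.homologyMapIso (A.pageScIso r h h') ≪≫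
    (A.pageSc r h h').moduleCatHomologyIso ≪≫
    (Submodule.quotEquivOfEq (LinearMap.range (A.pageSc r h h').moduleCatToCycles)
      ((LinearMap.range (A.d r h)).submoduleOf (LinearMap.ker (A.d r h'))) (by
      ext x
      constructor
      · rintro ⟨y, hy⟩
        exact ⟨y, congrArg Subtype.val hy⟩
      · rintro ⟨y, hy⟩
        exact ⟨y, Subtype.ext hy⟩)).toModuleIso

/-- The (homology) spectral sequence of a filtered complex, starting with the page `E^1`. -/
noncomputable def spectralSequence (A : FilteredComplex R) :
    SpectralSequence (ModuleCat.{0} R)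
      (fun r => ComplexShape.up' ((-r, r - 1) : ℤ × ℤ)) 1 where
  page r _ := A.page r
  iso r r' j hrr' _ :=
    A.pageHomologyIso r (i := j - (-r, r - 1)) (sub_add_cancel _ _) rfl ≪≫
      ((homologyEquiv r (sub_add_cancel j _) rfl).symm.toModuleIso : _ ≅
        ModuleCat.of R (A.E (r + 1) j)) ≪≫
      eqToIso (by subst hrr'; rfl)

end FilteredComplex

/-- A first quadrant double complex of modules, with the convention that the two
differentials anticommute. The groups are zero outside the first quadrant. -/
structure DoubleComplex (R : Type) [CommRing R] where
  /-- the bigraded group -/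
  C : ℕ → ℕ → ModuleCat.{0} R
  /-- the differential lowering the first index -/
  d' : ∀ p q, C (p + 1) q →ₗ[R] C p q
  /-- the differential lowering the second index -/
  d'' : ∀ p q, C p (q + 1) →ₗ[R] C p q
  d'_d' : ∀ p q x, d' p q (d' (p + 1) q x) = 0
  d''_d'' : ∀ p q x, d'' p q (d'' p (q + 1) x) = 0
  anticomm : ∀ p q x, d' p q (d'' (p + 1) q x) + d'' p q (d' p (q + 1) x) = 0

namespace DoubleComplex

open DirectSum

variable (C : DoubleComplex R)

/-- The direct sum of all the groups of the total complex. -/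
abbrev Tot : Type := ⨁ i : ℕ × ℕ, C.C i.1 i.2

/-- The differential `d'`, as a map into the total complex (zero on `C_{0,q}`). -/
noncomputable def left : ∀ p q : ℕ, C.C p q →ₗ[R] C.Tot
  | 0, _ => 0
  | p + 1, q => (lof R (ℕ × ℕ) (fun i => C.C i.1 i.2) (p, q)).comp (C.d' p q)

/-- The differential `d''`, as a map into the total complex (zero on `C_{p,0}`). -/
noncomputable def right : ∀ p q : ℕ, C.C p q →ₗ[R] C.Tot
  | _, 0 => 0
  | p, q + 1 => (lof R (ℕ × ℕ) (fun i => C.C i.1 i.2) (p, q)).comp (C.d'' p q)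

/-- The differential `D = d' + d''` of the total complex. -/
noncomputable def D : C.Tot →ₗ[R] C.Tot :=
  toModule R (ℕ × ℕ) C.Tot fun i => C.left i.1 i.2 + C.right i.1 i.2

lemma D_lof (p q : ℕ) (x : C.C p q) :
    C.D (lof R (ℕ × ℕ) (fun i => C.C i.1 i.2) (p, q) x) = C.left p q x + C.right p q x :=
  toModule_lof (ι := ℕ × ℕ) (M := fun i => C.C i.1 i.2) R (p, q) x

lemma D_left_add_D_right (p q : ℕ) (x : C.C p q) : C.D (C.left p q x) + C.D (C.right p q x) = 0 := by
  have h1 : ∀ (p q : ℕ) (x : C.C (p + 1) q), C.D (C.left (p + 1) q x) = C.right p q (C.d' p q x) := by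
    intro p q x
    refine (C.D_lof p q _).trans ?_
    cases p with
    | zero => simp [left]
    | succ p => simp [left, C.d'_d']
  have h2 : ∀ (p q : ℕ) (x : C.C p (q + 1)), C.D (C.right p (q + 1) x) = C.left p q (C.d'' p q x) := by
    intro p q x
    refine (C.D_lof p q _).trans ?_
    cases q with
    | zero => simp [right]
    | succ q => simp [right, C.d''_d'']
  cases p with
  | zero =>
    cases q with
    | zero => simp [left, right]
    | succ q => rw [h2]; simp [left]
  | succ p =>
    cases q with
    | zero => rw [h1]; simp [right]
    | succ q =>
      rw [h1, h2, add_comm]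
      simp only [left, right, LinearMap.comp_apply]
      rw [← map_add, C.anticomm, map_zero]

lemma D_D (x : C.Tot) : C.D (C.D x) = 0 := by
  suffices h : C.D.comp C.D = 0 from LinearMap.congr_fun h x
  refine linearMap_ext (ι := ℕ × ℕ) (M := fun i => C.C i.1 i.2) R fun ⟨p, q⟩ => ?_
  refine LinearMap.ext fun x => ?_
  simp only [LinearMap.comp_apply, LinearMap.zero_apply]
  rw [D_lof, map_add]
  exact C.D_left_add_D_right p q x

/-- The second filtration of the total complex: `⨁_{j ≤ p} C_{n-j,j}` in degree `n`. -/
def filtrationII (p n : ℤ) : Submodule R C.Tot where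
  carrier := {x | ∀ i : ℕ × ℕ, ¬((i.1 + i.2 : ℤ) = n ∧ (i.2 : ℤ) ≤ p) → x i = 0}
  zero_mem' _ _ := rfl
  add_mem' hx hy i hi := by rw [DirectSum.add_apply, hx i hi, hy i hi, add_zero]
  smul_mem' c x hx i hi := by rw [DirectSum.smul_apply, hx i hi, smul_zero]

lemma lof_mem_filtrationII {p n : ℤ} {i j : ℕ} (h : (i + j : ℤ) = n) (hj : (j : ℤ) ≤ p)
    (x : C.C i j) : lof R (ℕ × ℕ) (fun i => C.C i.1 i.2) (i, j) x ∈ C.filtrationII p n := by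
  intro k hk
  refine DirectSum.of_eq_of_ne (β := fun i : ℕ × ℕ => C.C i.1 i.2) (i, j) k x ?_
  rintro rfl
  exact hk ⟨h, hj⟩

lemma D_mem_filtrationII {p n : ℤ} {x : C.Tot} (hx : x ∈ C.filtrationII p n) :
    C.D x ∈ C.filtrationII p (n - 1) := by
  classical
  rw [← DirectSum.sum_support_of x, map_sum]
  refine Submodule.sum_mem _ fun ⟨i, j⟩ hij => ?_
  have hij' : (i + j : ℤ) = n ∧ (j : ℤ) ≤ p := by
    by_contra h
    exact (DFinsupp.mem_support_iff.1 hij) (hx (i, j) h)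
  have := C.D_lof i j (x (i, j))
  change C.D (lof R (ℕ × ℕ) (fun i => C.C i.1 i.2) (i, j) (x (i, j))) ∈ _
  rw [this]
  refine Submodule.add_mem _ ?_ ?_
  · cases i with
    | zero => exact Submodule.zero_mem _
    | succ i => exact C.lof_mem_filtrationII (by push_cast at hij'; lia) hij'.2 _
  · cases j with
    | zero => exact Submodule.zero_mem _
    | succ j => exact C.lof_mem_filtrationII (by push_cast at hij'; lia) (by lia) _

/-- The total complex, filtered by the second index. -/
noncomputable def filteredII : FilteredComplex R where
  T := ModuleCat.of R C.Tot
  D := C.D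
  D_D := C.D_D
  F := C.filtrationII
  F_mono _ h _ hx i hi := hx i fun hi' => hi ⟨hi'.1, hi'.2.trans h⟩
  D_mem := C.D_mem_filtrationII

/-- The second spectral sequence of a double complex. -/
noncomputable def secondSpectralSequence :
    SpectralSequence (ModuleCat.{0} R)
      (fun r => ComplexShape.up' ((-r, r - 1) : ℤ × ℤ)) 1 :=
  C.filteredII.spectralSequence

open HomologicalComplex in
/-- The double complex obtained from a complex `⋯ → K₂ → K₁ → K₀` of chain complexes by the usual
sign trick: `C_{n,k} = (K_k)_n`, `d' = ∂`, and `d''` is `(-1)^n ρ_n`. -/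
noncomputable def ofSignTrick (K : ℕ → ChainComplex (ModuleCat.{0} R) ℕ)
    (ρ : ∀ k, K (k + 1) ⟶ K k) (hρ : ∀ k, ρ (k + 1) ≫ ρ k = 0) : DoubleComplex R where
  C n k := (K k).X n
  d' n k := ((K k).d (n + 1) n).hom
  d'' n k := (-1 : R) ^ n • ((ρ k).f n).hom
  d'_d' n k x := by
    rw [← ModuleCat.comp_apply, (K k).d_comp_d]; rfl
  d''_d'' n k x := by
    have : ((ρ k).f n).hom (((ρ (k + 1)).f n).hom x) = 0 := by
      rw [← ModuleCat.comp_apply, ← comp_f, hρ]; rfl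
    simp [this]
  anticomm n k x := by
    have : ((ρ k).f n).hom (((K (k + 1)).d (n + 1) n).hom x) =
        ((K k).d (n + 1) n).hom (((ρ k).f (n + 1)).hom x) := by
      rw [← ModuleCat.comp_apply, ← ModuleCat.comp_apply, (ρ k).comm]
    simp [this, pow_succ]

end DoubleComplex

/-- A homology spectral sequence starting with `E^1`. -/
abbrev HomologySpectralSequence (R : Type) [CommRing R] : Type 1 :=
  SpectralSequence (ModuleCat.{0} R) (fun r => ComplexShape.up' ((-r, r - 1) : ℤ × ℤ)) 1

/-- A spectral sequence is first quadrant if all groups outside the first quadrant vanish. -/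
def IsFirstQuadrant (E : HomologySpectralSequence R) : Prop :=
  ∀ r : ℤ, ∀ hr : 1 ≤ r, ∀ p q : ℤ, p < 0 ∨ q < 0 → Subsingleton ((E.page r hr).X (p, q))

/-- Convergence of a first quadrant spectral sequence to the graded group `H`: each `H n` has a
filtration `0 = Φ_{-1} ⊆ Φ_0 ⊆ ⋯ ⊆ Φ_n = H n` with `E^∞_{p,q} ≅ Φ_p / Φ_{p-1}` in degree
`p + q`. Here `E^∞_{p,q}` is the stable value `E^r_{p,q}`, `r > max {p, q + 1}`. -/
def ConvergesTo (E : HomologySpectralSequence R) (H : ℕ → ModuleCat.{0} R) : Prop :=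
  IsFirstQuadrant E ∧
    ∃ Φ : ∀ n : ℕ, ℤ → Submodule R (H n),
      (∀ n, Monotone (Φ n)) ∧ (∀ n, ∀ p < 0, Φ n p = ⊥) ∧ (∀ n : ℕ, ∀ p : ℤ, n ≤ p → Φ n p = ⊤) ∧
        ∀ (n : ℕ) (p q : ℤ), p + q = n → ∀ r : ℤ, ∀ hr : 1 ≤ r, max p (q + 1) < r →
          Nonempty ((E.page r hr).X (p, q) ≅
            ModuleCat.of R (Φ n p ⧸ (Φ n (p - 1)).submoduleOf (Φ n p)))

end SpectralSequences

end MultiplePoint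

namespace MultiplePoint

section MultiplePointSpaces

open Geometry

variable {E F : Type} [NormedAddCommGroup E] [NormedSpace ℝ E]

/-- Local finiteness of a geometric simplicial complex: each point of the underlying space has a
neighbourhood meeting only finitely many simplices. -/
def IsLocallyFinite (K : SimplicialComplex ℝ E) : Prop :=
  ∀ x ∈ K.space, ∃ U ∈ nhds x, {s ∈ K.faces | (convexHull ℝ (s : Set E) ∩ U).Nonempty}.Finite

/-- The restriction of `f` to the space of `K` is a simplicial map onto the space of `L` with finite
fibres. (The values of `f` outside the space of `K` are irrelevant.) -/
structure IsFiniteSurjectiveSimplicial [NormedAddCommGroup F] [NormedSpace ℝ F]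
    (K : SimplicialComplex ℝ E) (L : SimplicialComplex ℝ F) (f : E → F) : Prop where
  /-- `f` maps the vertices of a simplex of `K` onto the vertices of a simplex of `L` -/
  map_face : ∀ s ∈ K.faces, ∃ t ∈ L.faces, (t : Set F) = f '' s
  /-- `f` is affine on each simplex of `K` -/
  affine : ∀ s ∈ K.faces, ∀ w : E → ℝ, (∀ v ∈ s, 0 ≤ w v) → ∑ v ∈ s, w v = 1 →
    f (∑ v ∈ s, w v • v) = ∑ v ∈ s, w v • f v
  surjOn : Set.SurjOn f K.space L.space
  finite_fibre : ∀ y ∈ L.space, {x ∈ K.space | f x = y}.Finite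

/-- The `(p+1)`-fold fibred product `W^{p+1}(f) = X ×_Y ⋯ ×_Y X` of `f : X → Y`. -/
def fibredPowerSpace (f : E → F) (X : Set E) (p : ℕ) : Set (Fin (p + 1) → E) :=
  {x | (∀ i, x i ∈ X) ∧ ∀ i j, f (x i) = f (x j)}

/-- The `(p+1)`-st multiple point space `D^{p+1}(f)` of `f : X → Y`: the closure in `X^{p+1}` of the
set of tuples of pairwise distinct points with the same image. -/
def multiplePointSpace (f : E → F) (X : Set E) (p : ℕ) : Set (Fin (p + 1) → E) :=
  closure {x | x ∈ fibredPowerSpace f X p ∧ Function.Injective x} ∩ {x | ∀ i, x i ∈ X}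

/-- The sets of vertices of the triangulation of `W^{p+1}(f)` associated to a simplicial map `f`.
The simplex `(Γ_0 × ⋯ × Γ_p)/Y`, where `Γ_ℓ = [v^ℓ_0, …, v^ℓ_n]` are simplices of `K` with
`f(v^ℓ_j) = w_j` for a simplex `[w_0, …, w_n]`, has the vertices `(v^0_j, …, v^p_j)`. -/
def fibredPowerFaces (f : E → F) (K : SimplicialComplex ℝ E) (p : ℕ) :
    Set (Finset (Fin (p + 1) → E)) :=
  {s | (∀ ℓ, ∃ t ∈ K.faces, (t : Set E) = (fun a : Fin (p + 1) → E => a ℓ) '' s) ∧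
    (s : Set (Fin (p + 1) → E)) ⊆ fibredPowerSpace f K.space p ∧
    Set.InjOn (fun a : Fin (p + 1) → E => f (a 0)) s}

variable {f : E → F} {K : SimplicialComplex ℝ E} {p : ℕ} {s : Finset (Fin (p + 1) → E)}

lemma fibredPowerFaces_injOn (hs : s ∈ fibredPowerFaces f K p) (ℓ : Fin (p + 1)) :
    Set.InjOn (fun a : Fin (p + 1) → E => f (a ℓ)) s := fun _ ha _ hb hab =>
  hs.2.2 ha hb (((hs.2.1 ha).2 0 ℓ).trans (hab.trans ((hs.2.1 hb).2 ℓ 0)))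

lemma fibredPowerFaces_indep (hs : s ∈ fibredPowerFaces f K p) (ℓ : Fin (p + 1)) :
    AffineIndependent ℝ (fun a : s => (a : Fin (p + 1) → E) ℓ) := by
  obtain ⟨t, ht, h⟩ := hs.1 ℓ
  have hmem : ∀ a : s, (a : Fin (p + 1) → E) ℓ ∈ t := fun a => by
    rw [← Finset.mem_coe, h]
    exact ⟨a, a.2, rfl⟩
  let e : s ↪ t := ⟨fun a => ⟨_, hmem a⟩, fun a b hab =>
    Subtype.ext (fibredPowerFaces_injOn hs ℓ a.2 b.2 (congrArg f (congrArg Subtype.val hab)))⟩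
  exact (K.indep ht).comp_embedding e

/-- The triangulation of `W^{p+1}(f)` associated to the simplicial map `f`. -/
def fibredPower (f : E → F) (K : SimplicialComplex ℝ E) (p : ℕ) :
    SimplicialComplex ℝ (Fin (p + 1) → E) where
  faces := fibredPowerFaces f K p
  isRelLowerSet_faces := by
    classical
    intro s hs
    refine ⟨?_, fun t hts ht => ⟨fun ℓ => ?_, fun a ha => hs.2.1 (hts ha), hs.2.2.mono hts⟩⟩
    · obtain ⟨t, ht, h⟩ := hs.1 0
      have := K.nonempty_of_mem_faces ht
      rw [← Finset.coe_nonempty, h] at this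
      exact Finset.coe_nonempty.1 this.of_image
    · obtain ⟨u, hu, h⟩ := hs.1 ℓ
      refine ⟨t.image fun a => a ℓ, K.down_closed hu ?_ (ht.image _), Finset.coe_image⟩
      rw [← Finset.coe_subset, Finset.coe_image, h]
      exact Set.image_mono hts
  indep hs := AffineIndependent.of_comp
    (LinearMap.proj (R := ℝ) (φ := fun _ : Fin _ => E) 0).toAffineMap (fibredPowerFaces_indep hs 0)
  inter_subset_convexHull := by
    classical
    rintro s t hs ht x ⟨hxs, hxt⟩
    obtain ⟨w, hw0, hw1, rfl⟩ := Finset.mem_convexHull'.1 hxs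
    have key : ∀ a ∈ s, w a ≠ 0 → a ∈ t := by
      intro a ha hwa
      have h1 : ∀ ℓ, ∃ b ∈ t, b ℓ = a ℓ := by
        intro ℓ
        obtain ⟨u, hu, hus⟩ := hs.1 ℓ
        obtain ⟨u', hu', hut⟩ := ht.1 ℓ
        by_contra hcon
        have hx : ∀ r : Finset (Fin (p + 1) → E), ∀ v : Finset E,
            (v : Set E) = (fun a : Fin (p + 1) → E => a ℓ) '' r →
            (∑ a ∈ s, w a • a) ∈ convexHull ℝ (r : Set (Fin (p + 1) → E)) →
            (∑ a ∈ s, w a • a) ℓ ∈ convexHull ℝ (v : Set E) := by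
          intro r v hv hr
          rw [hv]
          have := Set.mem_image_of_mem (LinearMap.proj (R := ℝ) (φ := fun _ : Fin (p + 1) => E) ℓ) hr
          rwa [LinearMap.image_convexHull] at this
        have hmem := K.inter_subset_convexHull hu hu' ⟨hx s u hus hxs, hx t u' hut hxt⟩
        have hsub : (u ∩ u' : Set E) ⊆ (fun a : s => (a : Fin (p + 1) → E) ℓ) ''
            {b : s | ∃ c ∈ t, c ℓ = (b : Fin (p + 1) → E) ℓ} := by
          rintro y ⟨hy, hy'⟩
          rw [hus] at hy
          rw [hut] at hy'
          obtain ⟨b, hb, rfl⟩ := hy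
          obtain ⟨c, hc, hcb⟩ := hy'
          exact ⟨⟨b, hb⟩, ⟨c, hc, hcb⟩, rfl⟩
        have hmem' := convexHull_subset_affineSpan _ (convexHull_mono hsub hmem)
        have hsum : ∑ b : s, w b = 1 := by rw [← hw1]; exact Finset.sum_coe_sort s w
        refine hwa ((fibredPowerFaces_indep hs ℓ).eq_zero_of_affineCombination_mem_affineSpan
          (fs := Finset.univ) (w := fun b : s => w b) hsum (i := ⟨a, ha⟩) ?_ (Finset.mem_univ _)
          (s := {b : s | ∃ c ∈ t, c ℓ = (b : Fin (p + 1) → E) ℓ}) hcon)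
        rw [Finset.univ.affineCombination_eq_linear_combination _ _ hsum]
        have e : (∑ a ∈ s, w a • a) ℓ = ∑ b : s, w b • (b : Fin (p + 1) → E) ℓ := by
          rw [Finset.sum_apply]
          exact (Finset.sum_coe_sort s fun b => w b • b ℓ).symm
        rw [e] at hmem'
        exact hmem'
      obtain ⟨b, hb, hb0⟩ := h1 0
      have hab : b = a := by
        funext ℓ
        obtain ⟨c, hc, hcℓ⟩ := h1 ℓ
        have : c = b := ht.2.2 hc hb (by
          change f (c 0) = f (b 0)
          rw [(ht.2.1 hc).2 0 ℓ, hcℓ, (hs.2.1 ha).2 ℓ 0, hb0])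
        rw [← this, hcℓ]
      rwa [← hab]
    rw [← Finset.coe_inter]
    refine Finset.mem_convexHull'.2 ⟨w, fun y hy => hw0 y (Finset.mem_inter.1 hy).1, ?_, ?_⟩
    · rw [← hw1]
      refine Finset.sum_subset Finset.inter_subset_left fun a ha ha' => ?_
      by_contra h
      exact ha' (Finset.mem_inter.2 ⟨ha, key a ha h⟩)
    · refine Finset.sum_subset Finset.inter_subset_left fun a ha ha' => ?_
      by_cases h : w a = 0
      · rw [h, zero_smul]
      · exact (ha' (Finset.mem_inter.2 ⟨ha, key a ha h⟩)).elim

/-- The triangulation of `D^{p+1}(f)` associated to the simplicial map `f`: the subcomplex of the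
triangulation of `W^{p+1}(f)` formed by the simplices contained in `D^{p+1}(f)`. -/
def multiplePointComplex (f : E → F) (K : SimplicialComplex ℝ E) (p : ℕ) :
    SimplicialComplex ℝ (Fin (p + 1) → E) where
  faces := {s ∈ (fibredPower f K p).faces |
    convexHull ℝ (s : Set (Fin (p + 1) → E)) ⊆ multiplePointSpace f K.space p}
  isRelLowerSet_faces := fun _ hs => ⟨(fibredPower f K p).nonempty_of_mem_faces hs.1,
    fun _ hts ht => ⟨(fibredPower f K p).down_closed hs.1 hts ht,
      (convexHull_mono hts).trans hs.2⟩⟩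
  indep hs := (fibredPower f K p).indep hs.1
  inter_subset_convexHull hs ht := (fibredPower f K p).inter_subset_convexHull hs.1 ht.1

/-- The projection `ε^i` forgetting the `i`-th component. -/
def forget (i : Fin (p + 2)) (x : Fin (p + 2) → E) : Fin (p + 1) → E := x ∘ i.succAbove

/-- The action of a permutation of the components. -/
def permute (σ : Equiv.Perm (Fin (p + 1))) (x : Fin (p + 1) → E) : Fin (p + 1) → E := x ∘ σ

lemma fibredPower_reindex {q : ℕ} (φ : Fin (q + 1) → Fin (p + 1)) :
    IsNondegenerateSimplicial (fibredPower f K p) (fibredPower f K q) (fun x => x ∘ φ) := by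
  classical
  intro s hs
  refine ⟨fun a ha b hb hab => fibredPowerFaces_injOn hs (φ 0) ha hb
    (congrArg f (congrFun hab 0)), s.image fun x => x ∘ φ, ⟨fun ℓ => ?_, ?_, ?_⟩, Finset.coe_image⟩
  · obtain ⟨t, ht, h⟩ := hs.1 (φ ℓ)
    refine ⟨t, ht, ?_⟩
    rw [h, Finset.coe_image, Set.image_image]
    rfl
  · intro a ha
    obtain ⟨b, hb, rfl⟩ := Finset.mem_image.1 (Finset.mem_coe.1 ha)
    exact ⟨fun i => (hs.2.1 hb).1 _, fun i j => (hs.2.1 hb).2 _ _⟩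
  · rintro a ha a' ha' h
    rw [Finset.mem_coe] at ha ha'
    obtain ⟨b, hb, rfl⟩ := Finset.mem_image.1 ha
    obtain ⟨b', hb', rfl⟩ := Finset.mem_image.1 ha'
    rw [fibredPowerFaces_injOn hs (φ 0) hb hb' h]

set_option linter.unusedSectionVars false in
lemma multiplePointSpace_reindex {X : Set E} {q : ℕ} {φ : Fin (q + 1) → Fin (p + 1)}
    (hφ : Function.Injective φ) {x : Fin (p + 1) → E} (hx : x ∈ multiplePointSpace f X p) :
    x ∘ φ ∈ multiplePointSpace f X q := by
  refine ⟨?_, fun i => hx.2 _⟩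
  have hc : Continuous fun x : Fin (p + 1) → E => x ∘ φ := by fun_prop
  refine closure_mono ?_ (image_closure_subset_closure_image hc ⟨x, hx.1, rfl⟩)
  rintro _ ⟨y, ⟨⟨h1, h2⟩, h3⟩, rfl⟩
  exact ⟨⟨fun i => h1 _, fun i j => h2 _ _⟩, h3.comp hφ⟩

lemma multiplePoint_reindex {q : ℕ} {φ : Fin (q + 1) → Fin (p + 1)} (hφ : Function.Injective φ) :
    IsNondegenerateSimplicial (multiplePointComplex f K p) (multiplePointComplex f K q)
      (fun x => x ∘ φ) := by
  intro s hs
  obtain ⟨h1, t, ht, h⟩ := fibredPower_reindex φ s hs.1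
  refine ⟨h1, t, ⟨ht, ?_⟩, h⟩
  have := LinearMap.image_convexHull
    (LinearMap.funLeft ℝ E φ : (Fin (p + 1) → E) →ₗ[ℝ] (Fin (q + 1) → E)) (s : Set (Fin (p + 1) → E))
  change _ = convexHull ℝ ((fun x : Fin (p + 1) → E => x ∘ φ) '' s) at this
  rw [h, ← this]
  rintro _ ⟨x, hx, rfl⟩
  exact multiplePointSpace_reindex hφ (hs.2 hx)

lemma fibredPower_forget (i : Fin (p + 2)) :
    IsNondegenerateSimplicial (fibredPower f K (p + 1)) (fibredPower f K p) (forget i) :=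
  fibredPower_reindex i.succAbove

lemma multiplePoint_forget (i : Fin (p + 2)) :
    IsNondegenerateSimplicial (multiplePointComplex f K (p + 1)) (multiplePointComplex f K p)
      (forget i) :=
  multiplePoint_reindex Fin.succAbove_right_injective

lemma multiplePoint_permute (σ : Equiv.Perm (Fin (p + 1))) :
    IsNondegenerateSimplicial (multiplePointComplex f K p) (multiplePointComplex f K p)
      (permute σ) :=
  multiplePoint_reindex σ.injective

variable (R : Type) [CommRing R]

/-- The homomorphism `ρ = ∑ (-1)^i ε^i_#` from the chains of `W^{p+2}(f)` to those of
`W^{p+1}(f)` (the components being numbered from `0`). -/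
noncomputable def rho (f : E → F) (K : SimplicialComplex ℝ E) (p n : ℕ) :
    Chain R (fibredPower f K (p + 1)) n →ₗ[R] Chain R (fibredPower f K p) n :=
  ∑ i : Fin (p + 2), (-1 : R) ^ (i : ℕ) • Chain.map (fibredPower_forget i) n

lemma rho_apply (n : ℕ) (c : Chain R (fibredPower f K (p + 1)) n) :
    rho R f K p n c = ∑ i : Fin (p + 2), (-1 : R) ^ (i : ℕ) •
      Chain.map (fibredPower_forget i) n c := by
  simp [rho, LinearMap.sum_apply]

lemma rho_rho (n : ℕ) (c : Chain R (fibredPower f K (p + 2)) n) :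
    rho R f K p n (rho R f K (p + 1) n c) = 0 := by
  rw [rho_apply R n c, map_sum, ← sum_succAbove_succAbove R (p + 1) fun φ =>
    Chain.map (fibredPower_reindex (f := f) (K := K) φ) n c]
  refine Finset.sum_congr rfl fun i _ => ?_
  rw [map_smul, rho_apply, Finset.smul_sum]
  refine Finset.sum_congr rfl fun j _ => ?_
  rw [Chain.map_map _ _ (fibredPower_reindex (i.succAbove ∘ j.succAbove)) fun x => rfl]

lemma boundary_rho (n : ℕ) (c : Chain R (fibredPower f K (p + 1)) (n + 1)) :
    Chain.boundary _ n (rho R f K p (n + 1) c) = rho R f K p n (Chain.boundary _ n c) := by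
  simp only [rho_apply, map_sum, map_smul, Chain.boundary_map]

/-- `ρ` as a morphism of chain complexes. -/
noncomputable def rhoHom (f : E → F) (K : SimplicialComplex ℝ E) (p : ℕ) :
    simplicialChainComplex R (fibredPower f K (p + 1)) ⟶
      simplicialChainComplex R (fibredPower f K p) :=
  ChainComplex.ofHom (fun n => ModuleCat.ofHom (rho R f K p n)) fun n => by
    rw [simplicialChainComplex_d, simplicialChainComplex_d]
    refine (ModuleCat.ofHom_comp _ _).symm.trans (Eq.trans ?_ (ModuleCat.ofHom_comp _ _))
    exact congrArg ModuleCat.ofHom (LinearMap.ext (boundary_rho R n))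

lemma rhoHom_rhoHom (f : E → F) (K : SimplicialComplex ℝ E) (p : ℕ) :
    rhoHom R f K (p + 1) ≫ rhoHom R f K p = 0 := by
  refine HomologicalComplex.hom_ext _ _ fun n => ?_
  refine (ModuleCat.ofHom_comp _ _).symm.trans ?_
  exact congrArg ModuleCat.ofHom (LinearMap.ext (rho_rho R n))

/-- The module `C^Alt_n(D^{p+1}(f))` of alternating chains: the chains `c` with
`σ_# c = sign(σ) c` for all permutations `σ` of the components. -/
noncomputable def altChain (f : E → F) (K : SimplicialComplex ℝ E) (p n : ℕ) :
    Submodule R (Chain R (multiplePointComplex f K p) n) :=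
  ⨅ σ : Equiv.Perm (Fin (p + 1)),
    LinearMap.ker (Chain.map (multiplePoint_permute σ) n - sgn R σ • LinearMap.id)

variable {R} in
lemma mem_altChain {n : ℕ} {c : Chain R (multiplePointComplex f K p) n} :
    c ∈ altChain R f K p n ↔
      ∀ σ, Chain.map (multiplePoint_permute σ) n c = sgn R σ • c := by
  simp [altChain, Submodule.mem_iInf, sub_eq_zero]

variable {R} in
lemma boundary_mem_altChain {n : ℕ} {c : Chain R (multiplePointComplex f K p) (n + 1)}
    (hc : c ∈ altChain R f K p (n + 1)) : Chain.boundary _ n c ∈ altChain R f K p n := by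
  rw [mem_altChain] at hc ⊢
  intro σ
  rw [← Chain.boundary_map, hc, map_smul]

/-- The homomorphism `ε_#` induced by the projection forgetting the last component. -/
noncomputable def eps (f : E → F) (K : SimplicialComplex ℝ E) (p n : ℕ) :
    Chain R (multiplePointComplex f K (p + 1)) n →ₗ[R] Chain R (multiplePointComplex f K p) n :=
  Chain.map (multiplePoint_forget (Fin.last (p + 1))) n

variable {R} in
lemma eps_mem_altChain {n : ℕ} {c : Chain R (multiplePointComplex f K (p + 1)) n}
    (hc : c ∈ altChain R f K (p + 1) n) : eps R f K p n c ∈ altChain R f K p n := by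
  rw [mem_altChain] at hc ⊢
  intro σ
  let τ : Equiv.Perm (Fin (p + 2)) := finSuccEquivLast.symm.permCongr σ.optionCongr
  have hτ : sgn R τ = sgn R σ := by
    rw [sgn, sgn, Equiv.Perm.sign_permCongr, Equiv.optionCongr_sign]
  have h : ∀ x : Fin (p + 2) → E,
      permute σ (forget (Fin.last (p + 1)) x) = forget (Fin.last (p + 1)) (permute τ x) := by
    intro x
    funext i
    simp [permute, forget, τ, Equiv.permCongr_apply]
  have hr : IsNondegenerateSimplicial (multiplePointComplex f K (p + 1))
      (multiplePointComplex f K p)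
      (fun x => forget (Fin.last (p + 1)) (permute τ x)) :=
    multiplePoint_reindex (φ := τ ∘ (Fin.last (p + 1)).succAbove)
      (τ.injective.comp Fin.succAbove_right_injective)
  rw [eps, Chain.map_map _ _ hr h, ← Chain.map_map (multiplePoint_permute τ)
    (multiplePoint_forget (Fin.last (p + 1))) hr fun x => rfl, hc, map_smul, hτ]

variable {R} in
lemma eps_eps [IsDomain R] [CharZero R] {n : ℕ}
    {c : Chain R (multiplePointComplex f K (p + 2)) n} (hc : c ∈ altChain R f K (p + 2) n) :
    eps R f K p n (eps R f K (p + 1) n c) = 0 := by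
  apply Chain.eq_zero_of_eq_neg
  let a : Fin (p + 3) := (Fin.last (p + 1)).castSucc
  let b : Fin (p + 3) := Fin.last (p + 2)
  have hab : a ≠ b := (Fin.castSucc_lt_last _).ne
  let τ : Equiv.Perm (Fin (p + 3)) := Equiv.swap a b
  have hr : IsNondegenerateSimplicial (multiplePointComplex f K (p + 2))
      (multiplePointComplex f K p)
      (fun x => forget (Fin.last (p + 1)) (forget (Fin.last (p + 2)) x)) :=
    multiplePoint_reindex (φ := (Fin.last (p + 2)).succAbove ∘ (Fin.last (p + 1)).succAbove)
      (Fin.succAbove_right_injective.comp Fin.succAbove_right_injective)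
  have h : ∀ x : Fin (p + 3) → E,
      forget (Fin.last (p + 1)) (forget (Fin.last (p + 2)) (permute τ x)) =
        forget (Fin.last (p + 1)) (forget (Fin.last (p + 2)) x) := by
    intro x
    funext i
    have h1 : (i.castSucc.castSucc : Fin (p + 3)) ≠ a := fun h =>
      (Fin.castSucc_lt_last i).ne (Fin.castSucc_injective _ h)
    have h2 : (i.castSucc.castSucc : Fin (p + 3)) ≠ b := (Fin.castSucc_lt_last _).ne
    simp [permute, forget, τ, Equiv.swap_apply_of_ne_of_ne h1 h2]
  have h3 := (mem_altChain.1 hc) τ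
  have h4 : sgn R τ = -1 := by simp [sgn, τ, Equiv.Perm.sign_swap hab]
  rw [h4, neg_one_smul] at h3
  have h5 : ∀ c, eps R f K p n (eps R f K (p + 1) n c) = Chain.map hr n c := fun c => by
    rw [eps, eps, Chain.map_map _ _ hr fun x => rfl]
  rw [h5]
  conv_lhs => rw [← Chain.map_map (multiplePoint_permute τ) hr hr h, h3, map_neg]

/-- The alternating chain complex `C^Alt_•(D^{p+1}(f))`, whose homology is the alternating homology
`AH_*(D^{p+1}(f))`. -/
noncomputable def altChainComplex (f : E → F) (K : SimplicialComplex ℝ E) (p : ℕ) :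
    ChainComplex (ModuleCat.{0} R) ℕ :=
  ChainComplex.of (fun n => ModuleCat.of R (altChain R f K p n))
    (fun n => ModuleCat.ofHom ((Chain.boundary _ n).restrict fun _ => boundary_mem_altChain))
    fun n => by
      rw [← ModuleCat.ofHom_comp]
      refine congrArg ModuleCat.ofHom (LinearMap.ext fun c => Subtype.ext ?_)
      exact Chain.boundary_boundary _

lemma altChainComplex_d (n : ℕ) :
    (altChainComplex R f K p).d (n + 1) n =
      ModuleCat.ofHom ((Chain.boundary _ n).restrict fun _ => boundary_mem_altChain) :=
  ChainComplex.of_d (fun n => ModuleCat.of R (altChain R f K p n))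
    (fun n => ModuleCat.ofHom ((Chain.boundary _ n).restrict fun _ => boundary_mem_altChain)) n

/-- `ε_#` as a morphism of alternating chain complexes. -/
noncomputable def epsHom (f : E → F) (K : SimplicialComplex ℝ E) (p : ℕ) :
    altChainComplex R f K (p + 1) ⟶ altChainComplex R f K p :=
  ChainComplex.ofHom
    (fun n => ModuleCat.ofHom ((eps R f K p n).restrict fun _ => eps_mem_altChain)) fun n => by
    rw [altChainComplex_d, altChainComplex_d]
    refine (ModuleCat.ofHom_comp _ _).symm.trans (Eq.trans ?_ (ModuleCat.ofHom_comp _ _))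
    refine congrArg ModuleCat.ofHom (LinearMap.ext fun c => Subtype.ext ?_)
    exact Chain.boundary_map _ _

lemma epsHom_epsHom [IsDomain R] [CharZero R] (f : E → F) (K : SimplicialComplex ℝ E) (p : ℕ) :
    epsHom R f K (p + 1) ≫ epsHom R f K p = 0 := by
  refine HomologicalComplex.hom_ext _ _ fun n => ?_
  refine (ModuleCat.ofHom_comp _ _).symm.trans ?_
  exact congrArg ModuleCat.ofHom (LinearMap.ext fun c => Subtype.ext (eps_eps c.2))

/-- The double complex with `C_{n,k} = C_n(W^{k+1}(f))`, horizontal differential `∂` and vertical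
differential `ϱ = (-1)^n ρ`. -/
noncomputable def fibredPowerDoubleComplex (f : E → F) (K : SimplicialComplex ℝ E) :
    DoubleComplex R :=
  DoubleComplex.ofSignTrick (fun k => simplicialChainComplex R (fibredPower f K k))
    (rhoHom R f K) (rhoHom_rhoHom R f K)

/-- The double complex with `C_{n,k} = C^Alt_n(D^{k+1}(f))`, horizontal differential `∂` and vertical
differential `ϵ = (-1)^n ε_#`. -/
noncomputable def alternatingDoubleComplex [IsDomain R] [CharZero R] (f : E → F)
    (K : SimplicialComplex ℝ E) : DoubleComplex R :=
  DoubleComplex.ofSignTrick (altChainComplex R f K) (epsHom R f K) (epsHom_epsHom R f K)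

/-- The GVZ spectral sequence: the second spectral sequence of the fibred power double complex. -/
noncomputable def gvzSpectralSequence (f : E → F) (K : SimplicialComplex ℝ E) :
    HomologySpectralSequence R :=
  (fibredPowerDoubleComplex R f K).secondSpectralSequence

/-- The image-computing spectral sequence: the second spectral sequence of the alternating double
complex. -/
noncomputable def imageComputingSpectralSequence [IsDomain R] [CharZero R] (f : E → F)
    (K : SimplicialComplex ℝ E) : HomologySpectralSequence R :=
  (alternatingDoubleComplex R f K).secondSpectralSequence

end MultiplePointSpaces

end MultiplePoint

/-!
# Convergence of the GVZ and image-computing spectral sequences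

Both spectral sequences come from a double complex whose columns are chain complexes and whose rows
are resolutions of the chain groups of `Y`.

For any complex of chain complexes `⋯ → K₁ → K₀`, the first page of the second spectral sequence of
the associated double complex is the homology of the columns: an element of `Z^1_p` is sent to the
class of its component in the column `K_p` (`firstPageEquiv`, `firstPage_d`). If moreover the rows,
augmented by the groups of a chain complex `M`, are exact (`RowResolution`), then killing components
one column after the other (`RowResolution.exists_D_eq`) shows that the augmentation identifies the
homology of the total complex with that of `M`; as the filtration is finite in each degree, the
spectral sequence converges to the homology of `M` (`RowResolution.convergesTo`).

It remains to see that the rows are resolutions of `C_n(Y)`. Since the fibres of `f` are finite, `f`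
is injective on each simplex, and every simplex of `Y` lifts to a simplex of `X`
(`IsFiniteSurjectiveSimplicial.exists_section`). A simplex of `W^k(f)` is a `k`-tuple of simplices
of `X` over a common simplex of `Y`, so that a choice of lifts allows one to insert a further
component. Inserting it in the first place contracts the rows of the fibred powers
(`Chain.rho_insert_zero`). For the alternating rows, one takes the alternating sum of the insertions
in all places (`Chain.forgetLast_alternatingInsert`), which preserves alternating chains. Such an
insertion may leave `D^k(f)`, but this is harmless: an alternating chain of `W^k(f)` vanishes on
simplices with two equal components, and all other simplices lie in `D^k(f)` because an interior
point of a simplex lies in no other simplex of the same dimension. Hence `W^k(f)` and `D^k(f)`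
have the same alternating chains (`Chain.IsAlternating.exists_altChain`).
-/

open CategoryTheory

namespace MultiplePoint

/-! ### Homology classes of cycles -/

section HomologyClass

variable {R : Type} [CommRing R]

/-- The `q`-cycles of a chain complex of modules, as a submodule. Membership demands that all
differentials out of degree `q` vanish; only the one into degree `q - 1` can be nonzero, and in
degree `0` there is no condition. -/
def cycleSubmodule (K : ChainComplex (ModuleCat.{0} R) ℕ) (q : ℕ) : Submodule R (K.X q) :=
  ⨅ j, LinearMap.ker (K.d q j).hom

lemma mem_cycleSubmodule {K : ChainComplex (ModuleCat.{0} R) ℕ} {q : ℕ} {x : K.X q} :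
    x ∈ cycleSubmodule K q ↔ ∀ j, j + 1 = q → (K.d q j).hom x = 0 := by
  simp only [cycleSubmodule, Submodule.mem_iInf, LinearMap.mem_ker]
  refine ⟨fun h j _ => h j, fun h j => ?_⟩
  by_cases hj : j + 1 = q
  · exact h j hj
  · rw [K.shape _ _ hj]; rfl

/-- The inclusion of the submodule of cycles, as a morphism to the categorical object of cycles. -/
noncomputable def cycleLift (K : ChainComplex (ModuleCat.{0} R) ℕ) (q : ℕ) :
    ModuleCat.of R (cycleSubmodule K q) ⟶ K.cycles q :=
  K.liftCycles (ModuleCat.ofHom (cycleSubmodule K q).subtype) _ rfl (by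
    ext x
    exact (Submodule.mem_iInf _).1 x.2 _)

lemma cycleLift_i (K : ChainComplex (ModuleCat.{0} R) ℕ) (q : ℕ) :
    cycleLift K q ≫ K.iCycles q = ModuleCat.ofHom (cycleSubmodule K q).subtype :=
  K.liftCycles_i _ _ rfl _

/-- The homology class of a cycle. -/
noncomputable def homologyClass (K : ChainComplex (ModuleCat.{0} R) ℕ) (q : ℕ) :
    cycleSubmodule K q →ₗ[R] K.homology q :=
  (cycleLift K q ≫ K.homologyπ q).hom

lemma homologyClass_surjective (K : ChainComplex (ModuleCat.{0} R) ℕ) (q : ℕ) :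
    Function.Surjective (homologyClass K q) := by
  intro y
  obtain ⟨c, rfl⟩ := (ModuleCat.epi_iff_surjective (K.homologyπ q)).1 inferInstance y
  have hc : K.iCycles q c ∈ cycleSubmodule K q := mem_cycleSubmodule.2 fun j _ => by
    have := congrArg (fun g => g.hom c) (K.iCycles_d q j)
    exact this
  refine ⟨⟨K.iCycles q c, hc⟩, ?_⟩
  refine congrArg (K.homologyπ q) ?_
  refine (ModuleCat.mono_iff_injective (K.iCycles q)).1 inferInstance ?_
  have := congrArg (fun g => g.hom ⟨K.iCycles q c, hc⟩) (cycleLift_i K q)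
  exact this

lemma homologyClass_eq_zero {K : ChainComplex (ModuleCat.{0} R) ℕ} {q : ℕ}
    {x : cycleSubmodule K q} :
    homologyClass K q x = 0 ↔ ∃ y, (K.d (q + 1) q).hom y = x := by
  have hi := congrArg (fun g => g.hom x) (cycleLift_i K q)
  have hex := ShortComplex.exact_of_g_is_cokernel
    (ShortComplex.mk (K.toCycles (q + 1) q) (K.homologyπ q) (by simp))
    (K.homologyIsCokernel (q + 1) q (by simp))
  rw [ShortComplex.moduleCat_exact_iff] at hex
  constructor
  · intro h
    obtain ⟨y, hy⟩ := hex _ h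
    refine ⟨y, ?_⟩
    refine Eq.trans ?_ hi
    have h2 := congrArg (fun g => g.hom y) (K.toCycles_i (q + 1) q)
    exact h2.symm.trans (congrArg (K.iCycles q) hy)
  · rintro ⟨y, hy⟩
    have h2 := congrArg (fun g => g.hom y) (K.toCycles_i (q + 1) q)
    have h3 : K.toCycles (q + 1) q y = cycleLift K q x :=
      (ModuleCat.mono_iff_injective (K.iCycles q)).1 inferInstance
        (h2.trans (hy.trans hi.symm))
    refine (congrArg (K.homologyπ q) h3.symm).trans ?_
    exact congrArg (fun g => g.hom y) (K.toCycles_comp_homologyπ (q + 1) q)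

lemma map_mem_cycleSubmodule {K M : ChainComplex (ModuleCat.{0} R) ℕ} (φ : K ⟶ M) {q : ℕ}
    {x : K.X q} (hx : x ∈ cycleSubmodule K q) : (φ.f q).hom x ∈ cycleSubmodule M q := by
  rw [mem_cycleSubmodule] at hx ⊢
  intro j hj
  have := congrArg (fun g => g.hom x) (φ.comm q j)
  refine Eq.trans this ?_
  exact (congrArg (φ.f j).hom (hx j hj)).trans (map_zero _)

lemma homologyMap_homologyClass {K M : ChainComplex (ModuleCat.{0} R) ℕ} (φ : K ⟶ M) {q : ℕ}
    (x : cycleSubmodule K q) :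
    (HomologicalComplex.homologyMap φ q).hom (homologyClass K q x) =
      homologyClass M q ⟨(φ.f q).hom x, map_mem_cycleSubmodule φ x.2⟩ := by
  have h1 := congrArg (fun g => g.hom (cycleLift K q x))
    (HomologicalComplex.homologyπ_naturality φ q)
  refine Eq.trans h1 (congrArg (M.homologyπ q) ?_)
  refine (ModuleCat.mono_iff_injective (M.iCycles q)).1 inferInstance ?_
  have e1 := congrArg (fun g => g.hom x) (cycleLift_i K q)
  have e2 := congrArg (fun g => g.hom (⟨(φ.f q).hom x, map_mem_cycleSubmodule φ x.2⟩ :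
      cycleSubmodule M q)) (cycleLift_i M q)
  have e3 := congrArg (fun g => g.hom (cycleLift K q x)) (HomologicalComplex.cyclesMap_i φ q)
  refine Eq.trans e3 (Eq.trans ?_ e2.symm)
  exact congrArg (φ.f q).hom e1

end HomologyClass

end MultiplePoint

namespace MultiplePoint

section DoubleComplexes

open DirectSum

variable {R : Type} [CommRing R]

/-- The differential preserves the filtration. The index is written as it occurs in `B 1`. -/
lemma FilteredComplex.Z_zero (A : FilteredComplex R) (p n : ℤ) : A.Z (1 - 1) p n = A.F p n := by
  refine le_antisymm inf_le_left fun x hx => ⟨hx, ?_⟩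
  rw [sub_self, sub_zero]
  exact A.D_mem hx

namespace DoubleComplex

/-! ### The first page of the second spectral sequence -/

variable (C : DoubleComplex R)

/-- The element of the total complex with the single component `x` in position `(i, j)`. -/
noncomputable abbrev inj (i j : ℕ) : C.C i j →ₗ[R] C.Tot :=
  lof R (ℕ × ℕ) (fun i => C.C i.1 i.2) (i, j)

lemma inj_same (i j : ℕ) (x : C.C i j) : C.inj i j x (i, j) = x :=
  DirectSum.of_eq_same (β := fun i : ℕ × ℕ => C.C i.1 i.2) (i, j) x

lemma inj_ne {i j a b : ℕ} (x : C.C i j) (h : ¬ (a = i ∧ b = j)) : C.inj i j x (a, b) = 0 :=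
  DirectSum.of_eq_of_ne (β := fun i : ℕ × ℕ => C.C i.1 i.2) (i, j) (a, b) x fun e =>
    h (Prod.ext_iff.1 e)

/-- The components of the total differential. -/
lemma D_apply (x : C.Tot) (i k : ℕ) :
    C.D x (i, k) = C.d' i k (x (i + 1, k)) + C.d'' i k (x (i, k + 1)) := by
  suffices h : (component R (ℕ × ℕ) (fun i => C.C i.1 i.2) (i, k)).comp C.D =
      (C.d' i k).comp (component R (ℕ × ℕ) (fun i => C.C i.1 i.2) (i + 1, k)) +
        (C.d'' i k).comp (component R (ℕ × ℕ) (fun i => C.C i.1 i.2) (i, k + 1)) from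
    LinearMap.congr_fun h x
  refine linearMap_ext (ι := ℕ × ℕ) (M := fun i => C.C i.1 i.2) R fun ⟨a, b⟩ => ?_
  refine LinearMap.ext fun y => ?_
  have h1 : C.left a b y (i, k) = C.d' i k (C.inj a b y (i + 1, k)) := by
    cases a with
    | zero =>
      rw [C.inj_ne y (by lia), map_zero]; rfl
    | succ a =>
      by_cases h : i = a ∧ k = b
      · obtain ⟨rfl, rfl⟩ := h
        rw [inj_same]; exact C.inj_same _ _ _
      · rw [C.inj_ne y (by lia), map_zero]; exact C.inj_ne _ h
  have h2 : C.right a b y (i, k) = C.d'' i k (C.inj a b y (i, k + 1)) := by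
    cases b with
    | zero =>
      rw [C.inj_ne y (by lia), map_zero]; rfl
    | succ b =>
      by_cases h : i = a ∧ k = b
      · obtain ⟨rfl, rfl⟩ := h
        rw [inj_same]; exact C.inj_same _ _ _
      · rw [C.inj_ne y (by lia), map_zero]; exact C.inj_ne _ h
  change C.D (C.inj a b y) (i, k) = _ + _
  rw [C.D_lof, DirectSum.add_apply, h1, h2]
  rfl

lemma inj_mem {p n : ℤ} {i j : ℕ} (h : (i + j : ℤ) = n) (hj : (j : ℤ) ≤ p) (x : C.C i j) :
    C.inj i j x ∈ C.filtrationII p n :=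
  C.lof_mem_filtrationII h hj x

lemma mem_filtrationII {p n : ℤ} {x : C.Tot} : x ∈ C.filtrationII p n ↔
    ∀ i j : ℕ, ¬((i + j : ℤ) = n ∧ (j : ℤ) ≤ p) → x (i, j) = 0 :=
  ⟨fun h i j => h (i, j), fun h i => h i.1 i.2⟩

lemma mem_filtrationII_sub_one {p q : ℕ} {x : C.Tot} (hx : x ∈ C.filtrationII p (p + q))
    (h : x (q, p) = 0) : x ∈ C.filtrationII (p - 1) (p + q) := by
  rw [mem_filtrationII] at hx ⊢
  intro i j hij
  by_cases hj : i = q ∧ j = p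
  · obtain ⟨rfl, rfl⟩ := hj; exact h
  · exact hx i j (by lia)

section FirstPage

variable (K : ℕ → ChainComplex (ModuleCat.{0} R) ℕ) (ρ : ∀ k, K (k + 1) ⟶ K k)
  (hρ : ∀ k, ρ (k + 1) ≫ ρ k = 0)

/-- The component in position `(q, p)` of an element of the total complex, as an element of the
column `K p`. -/
noncomputable def columnComponent (q p : ℕ) : (ofSignTrick K ρ hρ).Tot →ₗ[R] (K p).X q :=
  component R (ℕ × ℕ) (fun i => (ofSignTrick K ρ hρ).C i.1 i.2) (q, p)

lemma columnComponent_D (q p : ℕ) (x : (ofSignTrick K ρ hρ).Tot) :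
    columnComponent K ρ hρ q p ((ofSignTrick K ρ hρ).D x) =
      ((K p).d (q + 1) q).hom (columnComponent K ρ hρ (q + 1) p x) +
        (-1 : R) ^ q • ((ρ p).f q).hom (columnComponent K ρ hρ q (p + 1) x) :=
  (ofSignTrick K ρ hρ).D_apply x q p

lemma columnComponent_eq_zero {q p : ℕ} {r n : ℤ} {x : (ofSignTrick K ρ hρ).Tot}
    (hx : x ∈ (ofSignTrick K ρ hρ).filtrationII r n) (h : ¬((q + p : ℤ) = n ∧ (p : ℤ) ≤ r)) :
    columnComponent K ρ hρ q p x = 0 :=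
  hx (q, p) h

/-- The element of the total complex with the single component `x` in the column `K p`. -/
noncomputable def columnInj (q p : ℕ) : (K p).X q →ₗ[R] (ofSignTrick K ρ hρ).Tot :=
  (ofSignTrick K ρ hρ).inj q p

lemma columnComponent_columnInj_same (q p : ℕ) (x : (K p).X q) :
    columnComponent K ρ hρ q p (columnInj K ρ hρ q p x) = x :=
  (ofSignTrick K ρ hρ).inj_same q p x

lemma columnComponent_columnInj_ne {i j q p : ℕ} (x : (K p).X q) (h : ¬ (i = q ∧ j = p)) :
    columnComponent K ρ hρ i j (columnInj K ρ hρ q p x) = 0 :=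
  (ofSignTrick K ρ hρ).inj_ne _ h

lemma columnInj_mem {q p : ℕ} {n : ℤ} (h : (q + p : ℤ) = n) (x : (K p).X q) :
    columnInj K ρ hρ q p x ∈ (ofSignTrick K ρ hρ).filtrationII p n :=
  (ofSignTrick K ρ hρ).inj_mem h le_rfl _

lemma component_mem_cycleSubmodule {p q : ℕ} {x : (ofSignTrick K ρ hρ).Tot}
    (hx : x ∈ (ofSignTrick K ρ hρ).filteredII.Z 1 p (p + q)) :
    columnComponent K ρ hρ q p x ∈ cycleSubmodule (K p) q := by
  rw [mem_cycleSubmodule]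
  rintro j rfl
  have h1 : columnComponent K ρ hρ j p ((ofSignTrick K ρ hρ).D x) = 0 :=
    columnComponent_eq_zero K ρ hρ hx.2 (by lia)
  rwa [columnComponent_D, columnComponent_eq_zero K ρ hρ (q := j) (p := p + 1) hx.1 (by lia),
    map_zero, smul_zero, add_zero] at h1

/-- The homology class, in the column `K p`, of the component of highest filtration of an element
of `Z^1_p`. -/
noncomputable def leadingClass (p q : ℕ) :
    (ofSignTrick K ρ hρ).filteredII.Z 1 p (p + q) →ₗ[R] (K p).homology q :=
  (homologyClass (K p) q).comp <| LinearMap.codRestrict (cycleSubmodule (K p) q)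
    ((columnComponent K ρ hρ q p).comp (Submodule.subtype _)) fun x =>
      component_mem_cycleSubmodule K ρ hρ x.2

lemma leadingClass_apply {p q : ℕ} (x : (ofSignTrick K ρ hρ).filteredII.Z 1 p (p + q)) :
    leadingClass K ρ hρ p q x = homologyClass (K p) q
      ⟨columnComponent K ρ hρ q p x.1, component_mem_cycleSubmodule K ρ hρ x.2⟩ := rfl

lemma leadingClass_surjective (p q : ℕ) : Function.Surjective (leadingClass K ρ hρ p q) := by
  intro y
  obtain ⟨⟨z, hz⟩, rfl⟩ := homologyClass_surjective _ _ y
  rw [mem_cycleSubmodule] at hz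
  refine ⟨⟨columnInj K ρ hρ q p z, columnInj_mem K ρ hρ (add_comm _ _) z, ?_⟩, ?_⟩
  · refine ((ofSignTrick K ρ hρ).mem_filtrationII).2 fun i j hij => ?_
    suffices h : columnComponent K ρ hρ i j
        ((ofSignTrick K ρ hρ).D (columnInj K ρ hρ q p z)) = 0 from h
    rw [columnComponent_D, columnComponent_columnInj_ne _ _ _ (i := i) (j := j + 1) z (by lia),
      map_zero, smul_zero, add_zero]
    by_cases h1 : i + 1 = q ∧ j = p
    · obtain ⟨rfl, rfl⟩ := h1
      rw [columnComponent_columnInj_same]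
      exact hz i rfl
    · rw [columnComponent_columnInj_ne _ _ _ _ h1, map_zero]
  · rw [leadingClass_apply]
    exact congrArg _ (Subtype.ext (columnComponent_columnInj_same _ _ _ _ _ _))

lemma ker_leadingClass (p q : ℕ) :
    LinearMap.ker (leadingClass K ρ hρ p q) =
      ((ofSignTrick K ρ hρ).filteredII.B 1 p (p + q)).submoduleOf
        ((ofSignTrick K ρ hρ).filteredII.Z 1 p (p + q)) := by
  ext ⟨(x : (ofSignTrick K ρ hρ).Tot), hxZ⟩
  rw [LinearMap.mem_ker, leadingClass_apply, homologyClass_eq_zero]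
  refine Iff.trans ?_ (FilteredComplex.mem_B (A := (ofSignTrick K ρ hρ).filteredII)).symm
  constructor
  · rintro ⟨y, hy⟩
    have hyF := columnInj_mem K ρ hρ (q := q + 1) (p := p) (n := p + q + 1)
      (by push_cast; ring) y
    have hDF := (ofSignTrick K ρ hρ).D_mem_filtrationII hyF
    rw [add_sub_cancel_right] at hDF
    have ha : (x : (ofSignTrick K ρ hρ).Tot) -
        (ofSignTrick K ρ hρ).D (columnInj K ρ hρ (q + 1) p y) ∈
        (ofSignTrick K ρ hρ).filtrationII (p - 1) (p + q) := by
      refine mem_filtrationII_sub_one _ (Submodule.sub_mem _ hxZ.1 hDF) ?_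
      change columnComponent K ρ hρ q p (_ - _) = 0
      rw [map_sub, columnComponent_D, columnComponent_columnInj_same,
        columnComponent_columnInj_ne _ _ _ _ (by lia), map_zero, smul_zero, add_zero, hy]
      exact sub_self _
    refine ⟨_, ?_, columnInj K ρ hρ (q + 1) p y, ?_, sub_add_cancel _ _⟩
    · rw [FilteredComplex.Z_zero]
      exact ha
    · rw [FilteredComplex.Z_zero, add_sub_cancel_right]
      exact hyF
  · rintro ⟨a, ha, (b : (ofSignTrick K ρ hρ).Tot), hb, hab⟩
    refine ⟨columnComponent K ρ hρ (q + 1) p b, ?_⟩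
    have h := congrArg (columnComponent K ρ hρ q p) hab
    refine Eq.trans ?_ h
    refine Eq.trans ?_ (map_add (columnComponent K ρ hρ q p) _ _).symm
    rw [columnComponent_eq_zero K ρ hρ ha.1 (by lia), zero_add]
    refine Eq.trans ?_ (columnComponent_D K ρ hρ q p b).symm
    rw [columnComponent_eq_zero K ρ hρ (q := q) (p := p + 1) hb.1 (by push_cast; lia),
      map_zero, smul_zero, add_zero]

/-- The first page of the second spectral sequence consists of the homology of the columns. -/
noncomputable def firstPageEquiv (p q : ℕ) :
    (ofSignTrick K ρ hρ).filteredII.E 1 ((p : ℤ), (q : ℤ)) ≃ₗ[R] (K p).homology q :=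
  (Submodule.quotEquivOfEq _ _ (ker_leadingClass K ρ hρ p q).symm).trans
    ((leadingClass K ρ hρ p q).quotKerEquivOfSurjective (leadingClass_surjective K ρ hρ p q))

/-- Under the identification of the first page with the homology of the columns, `d^1` is induced
by the morphisms between the columns, up to the sign of the sign trick. -/
lemma firstPage_d (hr : (1 : ℤ) ≤ 1) (p q : ℕ) :
    ((ofSignTrick K ρ hρ).secondSpectralSequence.page 1 hr).d
        (((p + 1 : ℕ) : ℤ), (q : ℤ)) ((p : ℤ), (q : ℤ)) ≫
        ((firstPageEquiv K ρ hρ p q).toModuleIso : _ ≅ (K p).homology q).hom =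
      ((firstPageEquiv K ρ hρ (p + 1) q).toModuleIso : _ ≅ (K (p + 1)).homology q).hom ≫
        ((-1 : ℤ) ^ q • HomologicalComplex.homologyMap (ρ p) q) := by
  have h : ((((p + 1 : ℕ) : ℤ), (q : ℤ)) : ℤ × ℤ) + (-1, 1 - 1) = ((p : ℤ), (q : ℤ)) := by
    simp
  have hd : ((ofSignTrick K ρ hρ).secondSpectralSequence.page 1 hr).d
        (((p + 1 : ℕ) : ℤ), (q : ℤ)) ((p : ℤ), (q : ℤ)) =
      ModuleCat.ofHom ((ofSignTrick K ρ hρ).filteredII.d 1 h) :=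
    FilteredComplex.page_d 1 h
  rw [hd]
  ext y
  obtain ⟨x, rfl⟩ := Submodule.Quotient.mk_surjective _ y
  change leadingClass K ρ hρ p q ⟨(ofSignTrick K ρ hρ).D x.1, _⟩ =
    (-1 : ℤ) ^ q • (HomologicalComplex.homologyMap (ρ p) q).hom
      (leadingClass K ρ hρ (p + 1) q x)
  have hsmul (y : (K p).homology q) : (-1 : ℤ) ^ q • y = (-1 : R) ^ q • y := by
    rw [← Int.cast_smul_eq_zsmul R, Int.cast_pow, Int.cast_neg, Int.cast_one]
  rw [hsmul, leadingClass_apply, leadingClass_apply, homologyMap_homologyClass, ← map_smul,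
    ← sub_eq_zero, ← map_sub, homologyClass_eq_zero]
  refine ⟨columnComponent K ρ hρ (q + 1) p x.1, ?_⟩
  refine Eq.trans ?_ (congrArg (fun t => t - _) (columnComponent_D K ρ hρ q p x.1).symm)
  exact (add_sub_cancel_right _ _).symm

end FirstPage

end DoubleComplex

end DoubleComplexes

end MultiplePoint

namespace MultiplePoint

section RowResolutions

open DirectSum

variable {R : Type} [CommRing R]

namespace DoubleComplex

/-! ### Convergence for double complexes with exact rows -/

/-- An augmentation of the rows `⋯ → C_{n,1} → C_{n,0}` of a double complex by the groups of a
chain complex `M`, compatible with `d'` and such that all augmented rows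
`⋯ → C_{n,1} → C_{n,0} → M_n → 0` are exact. -/
structure RowResolution (C : DoubleComplex R) (M : ChainComplex (ModuleCat.{0} R) ℕ) where
  /-- the augmentation -/
  aug : ∀ n, C.C n 0 →ₗ[R] M.X n
  aug_d' : ∀ n x, aug n (C.d' n 0 x) = (M.d (n + 1) n).hom (aug (n + 1) x)
  aug_d'' : ∀ n x, aug n (C.d'' n 0 x) = 0
  surjective : ∀ n, Function.Surjective (aug n)
  exact_zero : ∀ n x, aug n x = 0 → ∃ y, C.d'' n 0 y = x
  exact_succ : ∀ n k x, C.d'' n k x = 0 → ∃ y, C.d'' n (k + 1) y = x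

variable {C : DoubleComplex R} {M : ChainComplex (ModuleCat.{0} R) ℕ}

lemma filtrationII_le (p n : ℤ) : C.filtrationII p n ≤ C.filtrationII n n := fun _ hx i hi =>
  hx i fun hi' => hi ⟨hi'.1, by lia⟩

lemma mem_filtrationII_of_le {p p' n : ℤ} (h : n ≤ p') {x : C.Tot} (hx : x ∈ C.filtrationII p n) :
    x ∈ C.filtrationII p' n := fun i hi => hx i fun hi' => hi ⟨hi'.1, by lia⟩

lemma eq_zero_of_mem_filtrationII {p n : ℤ} (h : p < 0) {x : C.Tot}
    (hx : x ∈ C.filtrationII p n) : x = 0 :=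
  DFinsupp.ext fun i => hx i fun hi => by lia

variable (C) in
/-- The cycles of degree `n` of the total complex. -/
noncomputable def totalCycles (n : ℕ) : Submodule R C.Tot := C.filtrationII n n ⊓ LinearMap.ker C.D

lemma Z_le_totalCycles {n : ℕ} {p r : ℤ} (hr : p < r) {x : C.Tot} (hx : x ∈ C.filteredII.Z r p n) :
    x ∈ totalCycles C n :=
  ⟨filtrationII_le _ _ hx.1, eq_zero_of_mem_filtrationII (p := p - r) (by lia) hx.2⟩

namespace RowResolution

variable (S : RowResolution C M)

/-- A cycle of the total complex whose components of index less than `k` vanish, and whose image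
under the augmentation vanishes, is a boundary, of an element without component in the column
`0`. The components are killed one after the other, by exactness of the rows; there are only
finitely many of them as the double complex lies in the first quadrant. -/
lemma exists_D_eq (S : RowResolution C M) (m : ℕ) :
    ∀ (n : ℤ) (k : ℕ), n < k + m → ∀ z ∈ C.filtrationII n n,
    (∀ i j : ℕ, j < k → z (i, j) = 0) → C.D z = 0 → (∀ i, S.aug i (z (i, 0)) = 0) →
    ∃ y ∈ C.filtrationII (n + 1) (n + 1), (∀ i, y (i, 0) = 0) ∧ C.D y = z := by
  induction m with
  | zero =>
    intro n k hnk z hz hzk _ _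
    have : z = 0 := DFinsupp.ext fun i => by
      by_cases h : i.2 < k
      · exact hzk _ _ h
      · exact hz i fun hi => by lia
    exact ⟨0, Submodule.zero_mem _, fun _ => rfl, by rw [this, map_zero]⟩
  | succ m ih =>
    intro n k hnk z hz hzk hDz haug
    by_cases hn : n < k
    · exact ih n k (by lia) z hz hzk hDz haug
    -- `z (a, k)` is the first component that may be nonzero
    obtain ⟨a, ha⟩ : ∃ a : ℕ, (a : ℤ) = n - k := ⟨(n - k).toNat, by lia⟩
    obtain ⟨x, hx⟩ : ∃ x, C.d'' a k x = z (a, k) := by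
      cases k with
      | zero => exact S.exact_zero a _ (haug a)
      | succ k =>
        refine S.exact_succ a k _ ?_
        have h := C.D_apply z a k
        rw [hDz, hzk _ _ (Nat.lt_succ_self k), map_zero, zero_add] at h
        exact h.symm
    have hy : C.inj a (k + 1) x ∈ C.filtrationII (n + 1) (n + 1) :=
      C.inj_mem (by push_cast; lia) (by push_cast; lia) x
    have hDy := C.D_mem_filtrationII hy
    rw [add_sub_cancel_right] at hDy
    have hz' : ∀ i j : ℕ, j < k + 1 → (z - C.D (C.inj a (k + 1) x)) (i, j) = 0 := by
      intro i j hj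
      rw [DirectSum.sub_apply, D_apply, C.inj_ne _ (by lia), map_zero, zero_add]
      by_cases hjk : j = k
      · subst hjk
        by_cases hi : i = a
        · subst hi
          rw [inj_same, hx, sub_self]
        · rw [C.inj_ne _ (by lia), map_zero, sub_zero]
          exact hz (i, j) (by simp only; lia)
      · rw [C.inj_ne _ (by lia), map_zero, sub_zero]
        exact hzk _ _ (by lia)
    obtain ⟨y, hyF, hy0, hDy'⟩ := ih n (k + 1) (by push_cast; lia) _
      (Submodule.sub_mem _ hz (mem_filtrationII_of_le le_rfl hDy)) hz'
      (by rw [map_sub, hDz, C.D_D, sub_zero])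
      (fun i => by rw [hz' i 0 (Nat.succ_pos k), map_zero])
    refine ⟨y + C.inj a (k + 1) x, Submodule.add_mem _ hyF hy, fun i => ?_, ?_⟩
    · rw [DirectSum.add_apply, hy0, C.inj_ne _ (by lia), add_zero]
    · rw [map_add, hDy', sub_add_cancel]

lemma aug_mem_cycleSubmodule {n : ℕ} {x : C.Tot} (hx : x ∈ totalCycles C n) :
    S.aug n (x (n, 0)) ∈ cycleSubmodule M n := by
  rw [mem_cycleSubmodule]
  rintro j rfl
  have h := C.D_apply x j 0
  rw [show C.D x = 0 from hx.2] at h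
  rw [← S.aug_d', eq_neg_of_add_eq_zero_left h.symm, map_neg, S.aug_d'', neg_zero]

/-- The map from the cycles of the total complex to the homology of the augmentation. -/
noncomputable def totalClass (n : ℕ) : totalCycles C n →ₗ[R] M.homology n :=
  (homologyClass M n).comp <| LinearMap.codRestrict (cycleSubmodule M n)
    ((S.aug n).comp ((component R (ℕ × ℕ) (fun i => C.C i.1 i.2) (n, 0)).comp
      (Submodule.subtype _))) fun x => S.aug_mem_cycleSubmodule x.2

lemma totalClass_apply {n : ℕ} (x : totalCycles C n) : S.totalClass n x =
    homologyClass M n ⟨S.aug n ((x : C.Tot) (n, 0)), S.aug_mem_cycleSubmodule x.2⟩ := rfl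

lemma totalClass_surjective (n : ℕ) : Function.Surjective (S.totalClass n) := by
  intro y
  obtain ⟨⟨m, hm⟩, rfl⟩ := homologyClass_surjective _ _ y
  rw [mem_cycleSubmodule] at hm
  obtain ⟨x, rfl⟩ := S.surjective n m
  have hx : C.inj n 0 x ∈ C.filtrationII n n := C.inj_mem (by simp) (by simp) x
  have hDx := C.D_mem_filtrationII hx
  -- The differential of `x` is a cycle killed by the augmentation, hence the differential of an
  -- element `y` which does not affect the augmentation; then `x - y` is the cycle sought.
  obtain ⟨y, hy, hy0, hDy⟩ := S.exists_D_eq (n + 1) (n - 1) 0 (by push_cast; lia)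
    (C.D (C.inj n 0 x)) (mem_filtrationII_of_le le_rfl hDx)
    (fun _ _ h => (Nat.not_lt_zero _ h).elim) (C.D_D _) fun i => by
      rw [D_apply, map_add, S.aug_d'', add_zero, S.aug_d']
      by_cases hi : i + 1 = n
      · subst hi
        rw [inj_same]
        exact hm i rfl
      · rw [C.inj_ne _ (by lia), map_zero, map_zero]
  rw [sub_add_cancel] at hy
  refine ⟨⟨C.inj n 0 x - y, Submodule.sub_mem _ hx hy, ?_⟩, ?_⟩
  · change C.D (C.inj n 0 x - y) = 0
    rw [map_sub, hDy, sub_self]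
  · rw [totalClass_apply]
    refine congrArg _ (Subtype.ext ?_)
    change S.aug n ((C.inj n 0 x - y) (n, 0)) = S.aug n x
    rw [DirectSum.sub_apply, hy0, inj_same, sub_zero]

lemma totalClass_eq_zero {n : ℕ} (x : totalCycles C n) :
    S.totalClass n x = 0 ↔ ∃ y ∈ C.filtrationII (n + 1) (n + 1), C.D y = x := by
  rw [totalClass_apply, homologyClass_eq_zero]
  constructor
  · rintro ⟨m, hm⟩
    obtain ⟨w, rfl⟩ := S.surjective (n + 1) m
    rw [← S.aug_d'] at hm
    have hw : C.inj (n + 1) 0 w ∈ C.filtrationII (n + 1) (n + 1) :=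
      C.inj_mem (by simp) (by push_cast; lia) w
    have hDw := C.D_mem_filtrationII hw
    rw [add_sub_cancel_right] at hDw
    obtain ⟨y, hy, -, hDy⟩ := S.exists_D_eq (n + 1) n 0 (by push_cast; lia)
      ((x : C.Tot) - C.D (C.inj (n + 1) 0 w))
      (Submodule.sub_mem _ x.2.1 (mem_filtrationII_of_le le_rfl hDw))
      (fun _ _ h => (Nat.not_lt_zero _ h).elim)
      (by rw [map_sub, C.D_D, sub_zero]; exact x.2.2) fun i => by
        rw [DirectSum.sub_apply, D_apply, map_sub, map_add, S.aug_d'', add_zero]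
        by_cases hi : i = n
        · subst hi
          rw [inj_same, hm, sub_self]
        · rw [C.inj_ne _ (by lia), x.2.1 (i, 0) (by simp only; lia), map_zero, map_zero, map_zero,
            sub_zero]
    exact ⟨y + C.inj (n + 1) 0 w, Submodule.add_mem _ hy hw, by rw [map_add, hDy, sub_add_cancel]⟩
  · rintro ⟨y, -, hy⟩
    refine ⟨S.aug (n + 1) (y (n + 1, 0)), ?_⟩
    change _ = S.aug n ((x : C.Tot) (n, 0))
    rw [← S.aug_d', ← hy, D_apply, map_add, S.aug_d'', add_zero]

/-- The filtration of the homology of the augmentation: the `p`-th stage consists of the classes of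
the cycles lying in the `p`-th stage of the total complex. -/
noncomputable def homologyFiltration (n : ℕ) (p : ℤ) : Submodule R (M.homology n) :=
  ((C.filtrationII p n).submoduleOf (totalCycles C n)).map (S.totalClass n)

lemma homologyFiltration_mono (n : ℕ) : Monotone (S.homologyFiltration n) := fun _ _ h =>
  Submodule.map_mono fun _ hx => C.filteredII.F_mono n h hx

lemma homologyFiltration_of_neg (n : ℕ) {p : ℤ} (hp : p < 0) : S.homologyFiltration n p = ⊥ := by
  rw [eq_bot_iff]
  rintro _ ⟨x, hx, rfl⟩
  have : x = 0 := Subtype.ext (eq_zero_of_mem_filtrationII hp hx)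
  rw [this, map_zero]
  exact Submodule.zero_mem _

lemma homologyFiltration_of_le {n : ℕ} {p : ℤ} (hp : n ≤ p) : S.homologyFiltration n p = ⊤ := by
  rw [eq_top_iff]
  intro y _
  obtain ⟨x, rfl⟩ := S.totalClass_surjective n y
  exact ⟨x, mem_filtrationII_of_le hp x.2.1, rfl⟩

/-- The map from `Z^r_p` to the successive quotients of the filtration of the homology, for large
`r`. -/
noncomputable def stableClass {n : ℕ} {p r : ℤ} (hr : p < r) :
    C.filteredII.Z r p n →ₗ[R]
      S.homologyFiltration n p ⧸ (S.homologyFiltration n (p - 1)).submoduleOf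
        (S.homologyFiltration n p) :=
  (Submodule.mkQ _).comp <| LinearMap.codRestrict _
    ((S.totalClass n).comp (Submodule.inclusion fun _ hx => Z_le_totalCycles hr hx))
    fun x => ⟨⟨x.1, Z_le_totalCycles hr x.2⟩, x.2.1, rfl⟩

lemma stableClass_surjective {n : ℕ} {p r : ℤ} (hr : p < r) :
    Function.Surjective (S.stableClass (n := n) hr) := by
  intro y
  obtain ⟨⟨_, x, hx, rfl⟩, rfl⟩ := Submodule.Quotient.mk_surjective _ y
  refine ⟨⟨x.1, hx, ?_⟩, rfl⟩
  change C.D x ∈ C.filtrationII _ _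
  rw [show C.D x = 0 from x.2.2]
  exact Submodule.zero_mem _

lemma stableClass_eq_zero {n : ℕ} {p r : ℤ} (hr : p < r) (hr' : n + 1 < p + r)
    (x : C.filteredII.Z r p n) :
    S.stableClass hr x = 0 ↔ (x : C.filteredII.T) ∈ C.filteredII.B r p n := by
  refine (Submodule.Quotient.mk_eq_zero _).trans ?_
  rw [FilteredComplex.mem_B]
  obtain ⟨(x : C.Tot), hx⟩ := x
  have hxc := Z_le_totalCycles hr hx
  constructor
  · rintro ⟨⟨a, ha⟩, haF, hax⟩
    have h0 : S.totalClass n (⟨x, hxc⟩ - ⟨a, ha⟩) = 0 := by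
      rw [map_sub, sub_eq_zero]
      exact hax.symm
    obtain ⟨y, hy, hDy⟩ := (S.totalClass_eq_zero _).1 h0
    have hDy : C.D y = x - a := hDy
    refine ⟨a, ⟨haF, ?_⟩, y, ⟨mem_filtrationII_of_le (by lia) hy, ?_⟩, ?_⟩
    · change C.D a ∈ C.filtrationII _ _
      rw [show C.D a = 0 from ha.2]
      exact Submodule.zero_mem _
    · change C.D y ∈ C.filtrationII _ _
      rw [hDy, show p + r - 1 - (r - 1) = p by ring, add_sub_cancel_right]
      exact Submodule.sub_mem _ hx.1 (C.filteredII.F_mono n (by lia) haF)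
    · change a + C.D y = x
      rw [hDy, add_sub_cancel]
  · rintro ⟨(a : C.Tot), ha, (y : C.Tot), hy, hay⟩
    have hac := Z_le_totalCycles (by lia) ha
    refine ⟨⟨a, hac⟩, ha.1, ?_⟩
    refine sub_eq_zero.1 ((map_sub (S.totalClass n) ⟨a, hac⟩ ⟨x, hxc⟩).symm.trans ?_)
    rw [← neg_eq_zero, ← map_neg, S.totalClass_eq_zero]
    refine ⟨y, filtrationII_le _ _ hy.1, ?_⟩
    change C.D y = -(a - x)
    rw [← show a + C.D y = x from hay]
    abel

/-- If the rows of a double complex are resolutions of a chain complex `M`, its second spectral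
sequence converges to the homology of `M`. -/
theorem convergesTo (S : RowResolution C M) :
    ConvergesTo C.secondSpectralSequence fun n => M.homology n := by
  refine ⟨fun r hr p q hpq => ?_, S.homologyFiltration, S.homologyFiltration_mono,
    fun n p hp => S.homologyFiltration_of_neg n hp, fun n p hp => S.homologyFiltration_of_le hp,
    fun n p q hpq r hr hpqr => ?_⟩
  · change Subsingleton (C.filteredII.E r (p, q))
    refine ⟨fun a b => ?_⟩
    obtain ⟨a, rfl⟩ := Submodule.Quotient.mk_surjective _ a
    obtain ⟨b, rfl⟩ := Submodule.Quotient.mk_surjective _ b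
    rw [FilteredComplex.mk_eq_mk]
    have hab : (a : C.filteredII.T) - b ∈ C.filteredII.Z r p (p + q) := Submodule.sub_mem _ a.2 b.2
    refine FilteredComplex.mem_B.2 ⟨(a : C.filteredII.T) - b, ⟨?_, ?_⟩, 0, Submodule.zero_mem _, ?_⟩
    · intro i hi
      exact hab.1 i fun hi' => hi ⟨hi'.1, by lia⟩
    · have := hab.2
      rwa [show p - r = p - 1 - (r - 1) by ring] at this
    · rw [map_zero, add_zero]
  · have hr1 : p < r := (le_max_left _ _).trans_lt hpqr
    have hr2 : (n : ℤ) + 1 < p + r := by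
      have := (le_max_right p (q + 1)).trans_lt hpqr
      lia
    have key : ∀ m : ℤ, m = n → Nonempty ((C.filteredII.Z r p m ⧸
        (C.filteredII.B r p m).submoduleOf (C.filteredII.Z r p m)) ≃ₗ[R]
          (S.homologyFiltration n p ⧸ (S.homologyFiltration n (p - 1)).submoduleOf
            (S.homologyFiltration n p))) := by
      rintro _ rfl
      exact ⟨(Submodule.quotEquivOfEq _ _ (by
        ext x
        exact (S.stableClass_eq_zero hr1 hr2 x).symm)).trans
          ((S.stableClass hr1).quotKerEquivOfSurjective (S.stableClass_surjective hr1))⟩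
    obtain ⟨e⟩ := key (p + q) hpq
    exact ⟨e.toModuleIso⟩

end RowResolution

end DoubleComplex

end RowResolutions

end MultiplePoint

namespace MultiplePoint

section Geometry

open Geometry

variable {E F : Type} [NormedAddCommGroup E] [NormedSpace ℝ E]

/-! ### Simplices and the simplicial map -/

/-- A simplex containing an interior point of another simplex contains that simplex. -/
lemma face_subset_of_interior_mem {K : SimplicialComplex ℝ E} {s t : Finset E}
    (hs : s ∈ K.faces) (ht : t ∈ K.faces) {w : E → ℝ} (hw : ∀ v ∈ s, 0 < w v)
    (hw1 : ∑ v ∈ s, w v = 1) (hx : ∑ v ∈ s, w v • v ∈ convexHull ℝ (t : Set E)) : s ⊆ t := by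
  intro a ha
  by_contra hat
  have hxs : ∑ v ∈ s, w v • v ∈ convexHull ℝ (s : Set E) :=
    Finset.mem_convexHull'.2 ⟨w, fun v hv => (hw v hv).le, hw1, rfl⟩
  have hmem := K.inter_subset_convexHull hs ht ⟨hxs, hx⟩
  have hsub : (s ∩ t : Set E) ⊆ (fun v : s => (v : E)) '' {v : s | (v : E) ∈ t} :=
    fun y hy => ⟨⟨y, hy.1⟩, hy.2, rfl⟩
  have hmem' := convexHull_subset_affineSpan _ (convexHull_mono hsub hmem)
  have hsum : ∑ v : s, w v = 1 := by rw [← hw1]; exact Finset.sum_coe_sort s w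
  refine (hw a ha).ne' ((K.indep hs).eq_zero_of_affineCombination_mem_affineSpan
    (fs := Finset.univ) (w := fun v : s => w v) hsum (i := ⟨a, ha⟩) ?_ (Finset.mem_univ _)
    (s := {v : s | (v : E) ∈ t}) hat)
  rw [Finset.univ.affineCombination_eq_linear_combination _ _ hsum]
  rw [← Finset.sum_coe_sort s fun v => w v • v] at hmem'
  exact hmem'

lemma mem_space_of_mem_face {K : SimplicialComplex ℝ E} {s : Finset E} (hs : s ∈ K.faces) {x : E}
    (hx : x ∈ s) : x ∈ K.space :=
  K.convexHull_subset_space hs (subset_convexHull ℝ _ hx)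

namespace IsFiniteSurjectiveSimplicial

variable [NormedAddCommGroup F] [NormedSpace ℝ F] {K : SimplicialComplex ℝ E}
  {L : SimplicialComplex ℝ F} {f : E → F}

/-- As its fibres are finite, `f` does not collapse an edge. -/
lemma injOn (hf : IsFiniteSurjectiveSimplicial K L f) {s : Finset E} (hs : s ∈ K.faces) :
    Set.InjOn f s := by
  classical
  intro a ha b hb hab
  by_contra hne
  have hpair : ({a, b} : Finset E) ∈ K.faces :=
    K.down_closed hs (by intro x hx; simp at hx; rcases hx with rfl | rfl <;> assumption)
      ⟨a, by simp⟩
  have hfa : f a ∈ L.space := by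
    obtain ⟨t, ht, h⟩ := hf.map_face _ hs
    refine mem_space_of_mem_face ht ?_
    rw [← Finset.mem_coe, h]
    exact ⟨a, ha, rfl⟩
  have hmaps : ∀ r ∈ Set.Icc (0 : ℝ) 1,
      (1 - r) • a + r • b ∈ {x ∈ K.space | f x = f a} := by
    intro r hr
    let w : E → ℝ := fun x => if x = a then 1 - r else r
    have hwa : w a = 1 - r := if_pos rfl
    have hwb : w b = r := if_neg (Ne.symm hne)
    have hw0 : ∀ v ∈ ({a, b} : Finset E), 0 ≤ w v := by
      intro v _
      by_cases h : v = a
      · simp only [w, if_pos h]; linarith [hr.2]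
      · simp only [w, if_neg h]; exact hr.1
    have hw1 : ∑ v ∈ ({a, b} : Finset E), w v = 1 := by
      rw [Finset.sum_pair hne, hwa, hwb]; ring
    have h := hf.affine _ hpair w hw0 hw1
    rw [Finset.sum_pair hne, Finset.sum_pair hne, hwa, hwb, ← hab, ← add_smul, sub_add_cancel,
      one_smul] at h
    refine ⟨K.convexHull_subset_space hpair (Finset.mem_convexHull'.2 ⟨w, hw0, hw1, ?_⟩), h⟩
    rw [Finset.sum_pair hne, hwa, hwb]
  refine (hf.finite_fibre _ hfa).not_infinite (Set.infinite_of_injOn_mapsTo (f := fun r : ℝ =>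
    (1 - r) • a + r • b) ?_ hmaps (Set.Icc_infinite one_pos))
  intro r _ r' _ h
  have h' : (r - r') • (b - a) = 0 := by
    have h : (1 - r) • a + r • b = (1 - r') • a + r' • b := h
    rw [← sub_eq_zero] at h
    rw [← h]
    module
  rcases smul_eq_zero.1 h' with h' | h'
  · exact sub_eq_zero.1 h'
  · exact (hne (sub_eq_zero.1 h').symm).elim

/-- Each simplex of the target is the image of a simplex of the source: a simplex of the source
containing a preimage of the barycentre maps onto a simplex containing the given one. -/
lemma exists_face_image_eq (hf : IsFiniteSurjectiveSimplicial K L f) {t : Finset F}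
    (ht : t ∈ L.faces) : ∃ s ∈ K.faces, f '' s = t := by
  classical
  have hcard : 0 < (t.card : ℝ) := by exact_mod_cast (L.nonempty_of_mem_faces ht).card_pos
  let w : F → ℝ := fun _ => (t.card : ℝ)⁻¹
  have hw0 : ∀ v ∈ t, 0 < w v := fun _ _ => inv_pos.2 hcard
  have hw1 : ∑ v ∈ t, w v = 1 := by simp [w, hcard.ne']
  obtain ⟨y, hy, hyx⟩ := hf.surjOn (L.convexHull_subset_space ht
    (Finset.mem_convexHull'.2 ⟨w, fun v hv => (hw0 v hv).le, hw1, rfl⟩))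
  obtain ⟨u, hu, hyu⟩ := K.mem_space_iff.1 hy
  obtain ⟨c, hc0, hc1, rfl⟩ := Finset.mem_convexHull'.1 hyu
  rw [hf.affine u hu c hc0 hc1] at hyx
  obtain ⟨t', ht', htu⟩ := hf.map_face u hu
  have hsub : t ⊆ t' := by
    refine face_subset_of_interior_mem ht ht' hw0 hw1 ?_
    rw [← hyx]
    exact (convex_convexHull ℝ _).sum_mem hc0 hc1 fun v hv => subset_convexHull ℝ _ (by
      rw [htu]; exact ⟨v, hv, rfl⟩)
  have himg : f '' ((u.filter fun v => f v ∈ t : Finset E) : Set E) = t := by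
    ext z
    constructor
    · rintro ⟨v, hv, rfl⟩
      exact (Finset.mem_filter.1 hv).2
    · intro hz
      have hz' : z ∈ (t' : Set F) := hsub hz
      rw [htu] at hz'
      obtain ⟨v, hv, rfl⟩ := hz'
      exact ⟨v, Finset.mem_filter.2 ⟨hv, hz⟩, rfl⟩
  refine ⟨_, K.down_closed hu (Finset.filter_subset (fun v => f v ∈ t) u) ?_, himg⟩
  have := L.nonempty_of_mem_faces ht
  rw [← Finset.coe_nonempty, ← himg] at this
  exact Finset.coe_nonempty.1 this.of_image

end IsFiniteSurjectiveSimplicial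

/-- A choice, for each simplex `t` of `L`, of a simplex of `K` which `f` maps bijectively onto `t`:
`g t` sends each vertex of `t` to the vertex above it. -/
structure IsSimplexSection [NormedAddCommGroup F] [NormedSpace ℝ F] (K : SimplicialComplex ℝ E)
    (L : SimplicialComplex ℝ F) (f : E → F) (g : Set F → F → E) : Prop where
  image_mem : ∀ t ∈ L.faces, ∃ s ∈ K.faces, (s : Set E) = g t '' t
  apply_eq : ∀ t ∈ L.faces, ∀ w ∈ t, f (g t w) = w

lemma IsFiniteSurjectiveSimplicial.exists_section [NormedAddCommGroup F] [NormedSpace ℝ F]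
    {K : SimplicialComplex ℝ E} {L : SimplicialComplex ℝ F} {f : E → F}
    (hf : IsFiniteSurjectiveSimplicial K L f) : ∃ g, IsSimplexSection K L f g := by
  have h : ∀ t : Set F, ∃ g : F → E, ∀ u ∈ L.faces, (u : Set F) = t →
      (∃ s ∈ K.faces, (s : Set E) = g '' t) ∧ ∀ w ∈ t, f (g w) = w := by
    intro t
    by_cases ht : ∃ u ∈ L.faces, (u : Set F) = t
    · obtain ⟨u, hu, rfl⟩ := ht
      obtain ⟨s, hs, hsu⟩ := hf.exists_face_image_eq hu
      have hinj := hf.injOn hs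
      have : Nonempty E := ⟨0⟩
      refine ⟨Function.invFunOn f s, fun _ _ _ => ⟨⟨s, hs, ?_⟩, fun w hw => ?_⟩⟩
      · rw [← hsu]
        exact (hinj.invFunOn_image subset_rfl).symm
      · rw [← hsu] at hw
        exact Function.invFunOn_eq hw
    · exact ⟨fun _ => 0, fun u hu hut => (ht ⟨u, hu, hut⟩).elim⟩
  choose g hg using h
  exact ⟨g, fun t ht => (hg t t ht rfl).1, fun t ht => (hg t t ht rfl).2⟩

/-! ### Multiple points -/

section MultiplePoints

variable {K : SimplicialComplex ℝ E} {f : E → F} {p : ℕ} {s : Finset (Fin (p + 1) → E)}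

/-- Weights on the vertices of a simplex of the fibred power are weights on the vertices of each of
its projections. -/
lemma exists_weight_projection (hs : s ∈ fibredPowerFaces f K p) (ℓ : Fin (p + 1))
    (w : (Fin (p + 1) → E) → ℝ) :
    ∃ u ∈ K.faces, ∃ c : E → ℝ, (∀ v, v ∈ u ↔ ∃ a ∈ s, a ℓ = v) ∧ (∀ a ∈ s, c (a ℓ) = w a) ∧
      ∀ {G : Type} [AddCommGroup G] (φ : E → G), ∑ v ∈ u, φ v = ∑ a ∈ s, φ (a ℓ) := by
  classical
  obtain ⟨u, hu, hus⟩ := hs.1 ℓ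
  have hinj : Set.InjOn (fun a : Fin (p + 1) → E => a ℓ) s := fun a ha b hb hab =>
    fibredPowerFaces_injOn hs ℓ ha hb (congrArg f hab)
  have himg : u = s.image fun a => a ℓ := by
    rw [← Finset.coe_inj, hus, Finset.coe_image]
  have : Nonempty (Fin (p + 1) → E) := ⟨0⟩
  refine ⟨u, hu, fun v => w (Function.invFunOn (fun a : Fin (p + 1) → E => a ℓ) s v), fun v => ?_,
    fun a ha => ?_, fun φ => ?_⟩
  · rw [himg, Finset.mem_image]
  · exact congrArg w (hinj.leftInvOn_invFunOn ha)
  · rw [himg, Finset.sum_image hinj]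

variable [NormedAddCommGroup F] [NormedSpace ℝ F] {L : SimplicialComplex ℝ F}

/-- A point with positive barycentric coordinates in a simplex of `W^{p+1}(f)`, two components of
which never agree at all vertices, has pairwise distinct components. -/
lemma interior_mem_fibredPowerSpace (hf : IsFiniteSurjectiveSimplicial K L f)
    (hs : s ∈ fibredPowerFaces f K p) (hdist : ∀ i j, i ≠ j → ∃ a ∈ s, a i ≠ a j)
    {w : (Fin (p + 1) → E) → ℝ} (hw : ∀ a ∈ s, 0 < w a) (hw1 : ∑ a ∈ s, w a = 1) :
    (∑ a ∈ s, w a • a) ∈ fibredPowerSpace f K.space p ∧ Function.Injective (∑ a ∈ s, w a • a) := by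
  have hval : ∀ ℓ, (∑ a ∈ s, w a • a) ℓ = ∑ a ∈ s, w a • a ℓ := fun ℓ => by
    rw [Finset.sum_apply]; rfl
  have key : ∀ ℓ, ∃ u ∈ K.faces, ∃ c : E → ℝ, (∀ v, v ∈ u ↔ ∃ a ∈ s, a ℓ = v) ∧
      (∀ v ∈ u, 0 < c v) ∧ ∑ v ∈ u, c v = 1 ∧ ∑ v ∈ u, c v • v = (∑ a ∈ s, w a • a) ℓ ∧
        ∑ v ∈ u, c v • f v = ∑ a ∈ s, w a • f (a ℓ) := by
    intro ℓ
    obtain ⟨u, hu, c, hmem, hc, hsum⟩ := exists_weight_projection hs ℓ w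
    refine ⟨u, hu, c, hmem, fun v hv => ?_, ?_, ?_, ?_⟩
    · obtain ⟨a, ha, rfl⟩ := (hmem v).1 hv
      rw [hc a ha]; exact hw a ha
    · rw [hsum, ← hw1]
      exact Finset.sum_congr rfl fun a ha => hc a ha
    · rw [hsum, hval]
      exact Finset.sum_congr rfl fun a ha => by rw [hc a ha]
    · rw [hsum]
      exact Finset.sum_congr rfl fun a ha => by rw [hc a ha]
  have hhull : ∀ ℓ, ∃ u ∈ K.faces, (∀ v, v ∈ u ↔ ∃ a ∈ s, a ℓ = v) ∧
      (∑ a ∈ s, w a • a) ℓ ∈ convexHull ℝ (u : Set E) := by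
    intro ℓ
    obtain ⟨u, hu, c, hmem, hc0, hc1, hcx, -⟩ := key ℓ
    exact ⟨u, hu, hmem, Finset.mem_convexHull'.2 ⟨c, fun v hv => (hc0 v hv).le, hc1, hcx⟩⟩
  have himg : ∀ ℓ, f ((∑ a ∈ s, w a • a) ℓ) = ∑ a ∈ s, w a • f (a 0) := by
    intro ℓ
    obtain ⟨u, hu, c, -, hc0, hc1, hcx, hcf⟩ := key ℓ
    rw [← hcx, hf.affine u hu c (fun v hv => (hc0 v hv).le) hc1, hcf]
    exact Finset.sum_congr rfl fun a ha => by rw [(hs.2.1 ha).2 ℓ 0]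
  refine ⟨⟨fun ℓ => ?_, fun i j => (himg i).trans (himg j).symm⟩, fun i j hij => ?_⟩
  · obtain ⟨u, hu, -, h⟩ := hhull ℓ
    exact K.convexHull_subset_space hu h
  · by_contra hne
    obtain ⟨a, ha, haij⟩ := hdist i j hne
    obtain ⟨u, hu, c, hmem, hc0, hc1, hcx, -⟩ := key i
    obtain ⟨u', hu', hmem', hx'⟩ := hhull j
    -- an interior point of the `i`-th projection lies in the `j`-th one
    rw [← hij, ← hcx] at hx'
    have hsub := face_subset_of_interior_mem hu hu' hc0 hc1 hx'
    obtain ⟨b, hb, hbj⟩ := (hmem' _).1 (hsub ((hmem _).2 ⟨a, ha, rfl⟩))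
    have hab : b = a := fibredPowerFaces_injOn hs j hb ha (by
      change f (b j) = f (a j)
      rw [hbj, (hs.2.1 ha).2 i j])
    exact haij (by rw [← hbj, hab])

/-- A simplex of `W^{p+1}(f)` with pairwise distinct projections is a simplex of `D^{p+1}(f)`. -/
lemma mem_multiplePointComplex (hf : IsFiniteSurjectiveSimplicial K L f)
    (hs : s ∈ (fibredPower f K p).faces) (hdist : ∀ i j, i ≠ j → ∃ a ∈ s, a i ≠ a j) :
    s ∈ (multiplePointComplex f K p).faces := by
  refine ⟨hs, ?_⟩
  rintro x hx
  have hcard : 0 < (s.card : ℝ) := by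
    exact_mod_cast ((fibredPower f K p).nonempty_of_mem_faces hs).card_pos
  refine ⟨?_, fun ℓ => ?_⟩
  · obtain ⟨w, hw0, hw1, rfl⟩ := Finset.mem_convexHull'.1 hx
    -- move `x` into the interior of the simplex, in the direction of the barycentre
    let c : ℝ → (Fin (p + 1) → E) → ℝ := fun r a => (1 - r) * w a + r * (s.card : ℝ)⁻¹
    have hcont : Continuous fun r : ℝ => ∑ a ∈ s, c r a • a := by fun_prop
    have h0 : (0 : ℝ) ∈ closure (Set.Ioo (0 : ℝ) 1) := by
      rw [closure_Ioo zero_ne_one]; exact ⟨le_rfl, zero_le_one⟩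
    have hmaps : Set.MapsTo (fun r : ℝ => ∑ a ∈ s, c r a • a) (Set.Ioo 0 1)
        {x | x ∈ fibredPowerSpace f K.space p ∧ Function.Injective x} := by
      intro r hr
      refine interior_mem_fibredPowerSpace hf hs hdist (fun a ha => ?_) ?_
      · have h1 := mul_nonneg (sub_pos.2 hr.2).le (hw0 a ha)
        have h2 := mul_pos hr.1 (inv_pos.2 hcard)
        exact add_pos_of_nonneg_of_pos h1 h2
      · simp only [c]
        rw [Finset.sum_add_distrib, ← Finset.mul_sum, hw1, Finset.sum_const, nsmul_eq_mul]
        field_simp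
        ring
    have h := map_mem_closure hcont h0 hmaps
    simpa [c] using h
  · obtain ⟨u, hu, hus⟩ := hs.1 ℓ
    refine K.convexHull_subset_space hu ?_
    rw [hus]
    have := Set.mem_image_of_mem (LinearMap.proj (R := ℝ) (φ := fun _ : Fin (p + 1) => E) ℓ) hx
    rwa [LinearMap.image_convexHull] at this

end MultiplePoints

end Geometry

end MultiplePoint

namespace MultiplePoint

section RowContractions

open Geometry

variable {E F : Type} [NormedAddCommGroup E] [NormedSpace ℝ E] {K : SimplicialComplex ℝ E}
  {f : E → F} {p n : ℕ}

/-! ### Ordered simplices of the fibred powers -/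

/-- An ordered simplex of `W^{p+1}(f)`, given by its vertices. -/
def fibredSimplex (v : Fin (n + 1) → Fin (p + 1) → E)
    (hface : ∀ ℓ, ∃ t ∈ K.faces, (t : Set E) = Set.range fun a => v a ℓ)
    (hfib : ∀ a i j, f (v a i) = f (v a j)) (hinj : Function.Injective fun a => f (v a 0)) :
    OrderedSimplex (fibredPower f K p) n :=
  ⟨v, fun a b hab => hinj (congrArg (fun x : Fin (p + 1) → E => f (x 0)) hab), by
    classical
    refine ⟨Finset.univ.image v, ⟨fun ℓ => ?_, ?_, ?_⟩, by simp⟩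
    · obtain ⟨t, ht, h⟩ := hface ℓ
      refine ⟨t, ht, ?_⟩
      rw [h, Finset.coe_image, Finset.coe_univ, Set.image_univ, ← Set.range_comp]
      rfl
    · intro x hx
      obtain ⟨a, -, rfl⟩ := Finset.mem_image.1 (Finset.mem_coe.1 hx)
      refine ⟨fun ℓ => ?_, hfib a⟩
      obtain ⟨t, ht, h⟩ := hface ℓ
      refine mem_space_of_mem_face ht ?_
      rw [← Finset.mem_coe, h]
      exact ⟨a, rfl⟩
    · intro x hx y hy hxy
      obtain ⟨a, -, rfl⟩ := Finset.mem_image.1 (Finset.mem_coe.1 hx)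
      obtain ⟨b, -, rfl⟩ := Finset.mem_image.1 (Finset.mem_coe.1 hy)
      exact congrArg v (hinj hxy)⟩

namespace OrderedSimplex

lemma fibredPower_face (v : OrderedSimplex (fibredPower f K p) n) (ℓ : Fin (p + 1)) :
    ∃ t ∈ K.faces, (t : Set E) = Set.range fun a => v.1 a ℓ := by
  obtain ⟨s, hs, hsv⟩ := v.2.2
  obtain ⟨t, ht, h⟩ := hs.1 ℓ
  refine ⟨t, ht, ?_⟩
  rw [h, hsv, ← Set.range_comp]
  rfl

lemma fibredPower_apply_eq (v : OrderedSimplex (fibredPower f K p) n) (a : Fin (n + 1))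
    (i j : Fin (p + 1)) : f (v.1 a i) = f (v.1 a j) := by
  obtain ⟨s, hs, hsv⟩ := v.2.2
  exact (hs.2.1 (hsv ▸ ⟨a, rfl⟩ : v.1 a ∈ (s : Set _))).2 i j

lemma fibredPower_injective (v : OrderedSimplex (fibredPower f K p) n) (ℓ : Fin (p + 1)) :
    Function.Injective fun a => f (v.1 a ℓ) := by
  obtain ⟨s, hs, hsv⟩ := v.2.2
  have hmem : ∀ a, v.1 a ∈ (s : Set (Fin (p + 1) → E)) := fun a => hsv ▸ ⟨a, rfl⟩
  exact fun a b hab => v.2.1 (fibredPowerFaces_injOn hs ℓ (hmem a) (hmem b) hab)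

lemma range_perm {V : Type} [AddCommGroup V] [Module ℝ V] {K : SimplicialComplex ℝ V}
    (v : OrderedSimplex K n) (τ : Equiv.Perm (Fin (n + 1))) :
    Set.range (v.perm τ).1 = Set.range v.1 := by
  change Set.range (v.1 ∘ τ) = _
  rw [Set.range_comp, τ.surjective.range_eq, Set.image_univ]

end OrderedSimplex

lemma multiplePoint_le_fibredPower (f : E → F) (K : SimplicialComplex ℝ E) (p : ℕ) :
    IsNondegenerateSimplicial (multiplePointComplex f K p) (fibredPower f K p) id :=
  fun s hs => ⟨Function.injective_id.injOn, s, hs.1, by rw [Set.image_id]⟩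

/-- The vertices of the simplex of `L` below a simplex of a fibred power. -/
def baseSet (v : OrderedSimplex (fibredPower f K p) n) : Set F :=
  Set.range fun a => f (v.1 a 0)

lemma baseSet_perm (v : OrderedSimplex (fibredPower f K p) n) (τ : Equiv.Perm (Fin (n + 1))) :
    baseSet (v.perm τ) = baseSet v := by
  change Set.range ((fun a => f (v.1 a 0)) ∘ τ) = _
  rw [Set.range_comp, τ.surjective.range_eq, Set.image_univ]
  rfl

variable [NormedAddCommGroup F] [NormedSpace ℝ F] {L : SimplicialComplex ℝ F}

/-- The map `W^{p+1}(f) → Y` induced by `f`. -/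
def baseMap (f : E → F) (x : Fin (p + 1) → E) : F := f (x 0)

lemma fibredPower_baseMap (hf : IsFiniteSurjectiveSimplicial K L f) (p : ℕ) :
    IsNondegenerateSimplicial (fibredPower f K p) L (baseMap f) := by
  intro s hs
  obtain ⟨t, ht, h⟩ := hs.1 0
  obtain ⟨u, hu, hut⟩ := hf.map_face t ht
  refine ⟨hs.2.2, u, hu, ?_⟩
  rw [hut, h, Set.image_image]
  rfl

lemma multiplePoint_baseMap (hf : IsFiniteSurjectiveSimplicial K L f) (p : ℕ) :
    IsNondegenerateSimplicial (multiplePointComplex f K p) L (baseMap f) :=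
  fun s hs => fibredPower_baseMap hf p s hs.1

/-! ### Inserting a chosen component -/

variable {g : Set F → F → E}

lemma exists_baseSet_eq (hf : IsFiniteSurjectiveSimplicial K L f)
    (v : OrderedSimplex (fibredPower f K p) n) : ∃ t ∈ L.faces, (t : Set F) = baseSet v := by
  obtain ⟨s, hs, hsv⟩ := v.fibredPower_face 0
  obtain ⟨t, ht, hts⟩ := hf.map_face s hs
  refine ⟨t, ht, ?_⟩
  rw [hts, hsv, ← Set.range_comp]
  rfl

lemma section_apply_eq (hf : IsFiniteSurjectiveSimplicial K L f) (hg : IsSimplexSection K L f g)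
    (v : OrderedSimplex (fibredPower f K p) n) (a : Fin (n + 1)) (i : Fin (p + 1)) :
    f (g (baseSet v) (f (v.1 a 0))) = f (v.1 a i) := by
  obtain ⟨t, ht, htv⟩ := exists_baseSet_eq hf v
  rw [← htv, hg.apply_eq t ht _ (by rw [← Finset.mem_coe, htv]; exact ⟨a, rfl⟩)]
  exact v.fibredPower_apply_eq a 0 i

/-- The ordered simplex obtained from a simplex `v` of `W^{p+1}(f)` by inserting, as `j`-th
component, the chosen simplex of `K` with the same image as the components of `v`. -/
def insertSimplex (hf : IsFiniteSurjectiveSimplicial K L f) (hg : IsSimplexSection K L f g)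
    (j : Fin (p + 2)) (v : OrderedSimplex (fibredPower f K p) n) :
    OrderedSimplex (fibredPower f K (p + 1)) n :=
  have hval : ∀ a ℓ, f (j.insertNth (α := fun _ => E) (g (baseSet v) (f (v.1 a 0))) (v.1 a) ℓ) =
      f (v.1 a 0) := by
    intro a ℓ
    rcases Fin.eq_self_or_eq_succAbove j ℓ with rfl | ⟨i, rfl⟩
    · rw [Fin.insertNth_apply_same]
      exact section_apply_eq hf hg v a 0
    · rw [Fin.insertNth_apply_succAbove]
      exact v.fibredPower_apply_eq a i 0
  fibredSimplex (fun a => j.insertNth (g (baseSet v) (f (v.1 a 0))) (v.1 a)) (fun ℓ => by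
      rcases Fin.eq_self_or_eq_succAbove j ℓ with rfl | ⟨i, rfl⟩
      · simp only [Fin.insertNth_apply_same]
        obtain ⟨t, ht, htv⟩ := exists_baseSet_eq hf v
        obtain ⟨s, hs, hst⟩ := hg.image_mem t ht
        refine ⟨s, hs, ?_⟩
        rw [hst, htv]
        exact (Set.range_comp _ _).symm
      · simp only [Fin.insertNth_apply_succAbove]
        exact v.fibredPower_face i)
    (fun a i j => (hval a i).trans (hval a j).symm)
    fun a b hab => v.fibredPower_injective 0 (((hval a 0).symm.trans hab).trans (hval b 0))

/-- The ordered simplex of `W^1(f)` given by the chosen simplex of `K` above a simplex of `L`. -/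
def sectionSimplex (hg : IsSimplexSection K L f g) (v : OrderedSimplex L n) :
    OrderedSimplex (fibredPower f K 0) n :=
  have hval : ∀ a, f (g (Set.range v.1) (v.1 a)) = v.1 a := by
    intro a
    obtain ⟨t, ht, htv⟩ := v.2.2
    rw [← htv]
    exact hg.apply_eq t ht _ (by rw [← Finset.mem_coe, htv]; exact ⟨a, rfl⟩)
  fibredSimplex (fun a _ => g (Set.range v.1) (v.1 a)) (fun _ => by
      obtain ⟨t, ht, htv⟩ := v.2.2
      obtain ⟨s, hs, hst⟩ := hg.image_mem t ht
      refine ⟨s, hs, ?_⟩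
      rw [hst, htv]
      exact (Set.range_comp _ _).symm)
    (fun _ _ _ => rfl) fun a b hab => v.2.1 (((hval a).symm.trans hab).trans (hval b))

lemma baseMap_sectionSimplex (hg : IsSimplexSection K L f g) (v : OrderedSimplex L n)
    (a : Fin (n + 1)) : baseMap f ((sectionSimplex hg v).1 a) = v.1 a := by
  obtain ⟨t, ht, htv⟩ := v.2.2
  change f (g (Set.range v.1) (v.1 a)) = v.1 a
  rw [← htv]
  exact hg.apply_eq t ht _ (by rw [← Finset.mem_coe, htv]; exact ⟨a, rfl⟩)

namespace Chain

variable {R : Type} [CommRing R]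

/-- Insertion of the chosen simplex as `j`-th component, on chains. -/
noncomputable def insert (hf : IsFiniteSurjectiveSimplicial K L f)
    (hg : IsSimplexSection K L f g) (j : Fin (p + 2)) (n : ℕ) :
    Chain R (fibredPower f K p) n →ₗ[R] Chain R (fibredPower f K (p + 1)) n :=
  lift (fun v => of R (insertSimplex hf hg j v)) fun v τ => by
    rw [← of_perm]
    refine congrArg _ (Subtype.ext (funext fun a => ?_))
    change j.insertNth (α := fun _ => E) (g (baseSet (v.perm τ)) (f ((v.perm τ).1 a 0)))
        ((v.perm τ).1 a) =
      j.insertNth (α := fun _ => E) (g (baseSet v) (f (v.1 (τ a) 0))) (v.1 (τ a))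
    rw [baseSet_perm]
    rfl

lemma insert_of (hf : IsFiniteSurjectiveSimplicial K L f) (hg : IsSimplexSection K L f g)
    (j : Fin (p + 2)) (v : OrderedSimplex (fibredPower f K p) n) :
    insert hf hg j n (of R v) = of R (insertSimplex hf hg j v) := lift_of _ _ _

/-- The section of the augmentation `C_n(W^1(f)) → C_n(Y)` given by the chosen simplices. -/
noncomputable def sectionMap (hg : IsSimplexSection K L f g) (n : ℕ) :
    Chain R L n →ₗ[R] Chain R (fibredPower f K 0) n :=
  lift (fun v => of R (sectionSimplex hg v)) fun v τ => by
    rw [← of_perm]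
    refine congrArg _ (Subtype.ext (funext fun a => funext fun _ => ?_))
    change g (Set.range (v.perm τ).1) _ = g (Set.range v.1) _
    rw [OrderedSimplex.range_perm]
    rfl

lemma sectionMap_of (hg : IsSimplexSection K L f g) (v : OrderedSimplex L n) :
    sectionMap hg n (of R v) = of R (sectionSimplex hg v) := lift_of _ _ _

lemma map_baseMap_sectionMap (hf : IsFiniteSurjectiveSimplicial K L f)
    (hg : IsSimplexSection K L f g) (c : Chain R L n) :
    map (fibredPower_baseMap hf 0) n (sectionMap hg n c) = c := by
  suffices h : (map (fibredPower_baseMap hf 0) n).comp (sectionMap (R := R) hg n) =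
      LinearMap.id from LinearMap.congr_fun h c
  refine hom_ext fun v => ?_
  rw [LinearMap.comp_apply, sectionMap_of, map_of]
  exact congrArg _ (Subtype.ext (funext fun a => baseMap_sectionSimplex hg v a))

lemma map_forget_insert_self (hf : IsFiniteSurjectiveSimplicial K L f)
    (hg : IsSimplexSection K L f g) (j : Fin (p + 2)) (c : Chain R (fibredPower f K p) n) :
    map (fibredPower_forget j) n (insert hf hg j n c) = c := by
  suffices h : (map (fibredPower_forget j) n).comp (insert (R := R) hf hg j n) =
      LinearMap.id from LinearMap.congr_fun h c
  refine hom_ext fun v => ?_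
  rw [LinearMap.comp_apply, insert_of, map_of]
  refine congrArg _ (Subtype.ext (funext fun a => funext fun i => ?_))
  exact Fin.insertNth_apply_succAbove (α := fun _ => E) j _ _ i

/-- Forgetting a component of the simplex other than the inserted one. -/
lemma map_forget_insert (hf : IsFiniteSurjectiveSimplicial K L f)
    (hg : IsSimplexSection K L f g) {j : Fin (p + 3)} {i : Fin (p + 3)} {j' i' : Fin (p + 2)}
    (h1 : i.succAbove j' = j) (h2 : ∀ l, i.succAbove (j'.succAbove l) =
      j.succAbove (i'.succAbove l)) (c : Chain R (fibredPower f K (p + 1)) n) :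
    map (fibredPower_forget i) n (insert hf hg j n c) =
      insert hf hg j' n (map (fibredPower_forget i') n c) := by
  suffices h : (map (fibredPower_forget i) n).comp (insert (R := R) hf hg j n) =
      (insert hf hg j' n).comp (map (fibredPower_forget i') n) from LinearMap.congr_fun h c
  refine hom_ext fun v => ?_
  rw [LinearMap.comp_apply, LinearMap.comp_apply, insert_of, map_of, map_of, insert_of]
  have hbase : ∀ a, f ((mapSimplex (fibredPower_forget i') v).1 a 0) = f (v.1 a 0) := fun a =>
    v.fibredPower_apply_eq a _ _
  have hset : baseSet (mapSimplex (fibredPower_forget i') v) = baseSet v :=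
    congrArg Set.range (funext hbase)
  refine congrArg _ (Subtype.ext (funext fun a => funext fun k => ?_))
  change j.insertNth (α := fun _ => E) (g (baseSet v) (f (v.1 a 0))) (v.1 a) (i.succAbove k) =
    j'.insertNth (α := fun _ => E) (g (baseSet (mapSimplex (fibredPower_forget i') v))
      (f ((mapSimplex (fibredPower_forget i') v).1 a 0)))
      ((mapSimplex (fibredPower_forget i') v).1 a) k
  rw [hset, hbase]
  rcases Fin.eq_self_or_eq_succAbove j' k with rfl | ⟨l, rfl⟩
  · rw [h1, Fin.insertNth_apply_same, Fin.insertNth_apply_same]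
  · rw [h2, Fin.insertNth_apply_succAbove, Fin.insertNth_apply_succAbove]
    rfl

/-- Forgetting the only original component. -/
lemma map_forget_insert_zero (hf : IsFiniteSurjectiveSimplicial K L f)
    (hg : IsSimplexSection K L f g) {i j : Fin 2} (hij : i ≠ j)
    (c : Chain R (fibredPower f K 0) n) :
    map (fibredPower_forget i) n (insert hf hg j n c) =
      sectionMap hg n (map (fibredPower_baseMap hf 0) n c) := by
  suffices h : (map (fibredPower_forget i) n).comp (insert (R := R) hf hg j n) =
      (sectionMap hg n).comp (map (fibredPower_baseMap hf 0) n) from LinearMap.congr_fun h c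
  refine hom_ext fun v => ?_
  rw [LinearMap.comp_apply, LinearMap.comp_apply, insert_of, map_of, map_of, sectionMap_of]
  refine congrArg _ (Subtype.ext (funext fun a => funext fun k => ?_))
  change j.insertNth (α := fun _ => E) (g (baseSet v) (f (v.1 a 0))) (v.1 a) (i.succAbove k) =
    g (baseSet v) (f (v.1 a 0))
  rw [show i.succAbove k = j by fin_cases k; revert i j; decide, Fin.insertNth_apply_same]

/-! ### Contraction of the rows of the fibred power double complex -/

/-- Inserting the chosen simplex as first component is a contraction of the rows. -/
lemma rho_insert_zero (hf : IsFiniteSurjectiveSimplicial K L f) (hg : IsSimplexSection K L f g)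
    (c : Chain R (fibredPower f K (p + 1)) n) :
    rho R f K (p + 1) n (insert hf hg 0 n c) = c - insert hf hg 0 n (rho R f K p n c) := by
  rw [rho_apply, Fin.sum_univ_succ, map_forget_insert_self, rho_apply, map_sum, sub_eq_add_neg,
    ← Finset.sum_neg_distrib]
  congr 1
  · simp
  · refine Finset.sum_congr rfl fun i _ => ?_
    rw [map_forget_insert hf hg (j := 0) (i := i.succ) (j' := 0) (i' := i) (by simp) (by simp),
      map_smul, Fin.val_succ, pow_succ]
    simp

lemma rho_insert_zero_zero (hf : IsFiniteSurjectiveSimplicial K L f)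
    (hg : IsSimplexSection K L f g) (c : Chain R (fibredPower f K 0) n) :
    rho R f K 0 n (insert hf hg 0 n c) =
      c - sectionMap hg n (map (fibredPower_baseMap hf 0) n c) := by
  rw [rho_apply, Fin.sum_univ_two, map_forget_insert_self,
    map_forget_insert_zero hf hg (by decide : (1 : Fin 2) ≠ 0)]
  simp [sub_eq_add_neg]

lemma map_baseMap_reindex (hf : IsFiniteSurjectiveSimplicial K L f) {q : ℕ}
    (φ : Fin (q + 1) → Fin (p + 1)) (c : Chain R (fibredPower f K p) n) :
    map (fibredPower_baseMap hf q) n (map (fibredPower_reindex φ) n c) =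
      map (fibredPower_baseMap hf p) n c := by
  suffices h : (map (fibredPower_baseMap hf q) n).comp (map (fibredPower_reindex φ) n) =
      (map (fibredPower_baseMap hf p) n : Chain R (fibredPower f K p) n →ₗ[R] _) from
    LinearMap.congr_fun h c
  refine hom_ext fun v => ?_
  rw [LinearMap.comp_apply, map_of, map_of, map_of]
  exact congrArg _ (Subtype.ext (funext fun a => v.fibredPower_apply_eq a _ _))

lemma map_baseMap_forget (hf : IsFiniteSurjectiveSimplicial K L f) (i : Fin (p + 2))
    (c : Chain R (fibredPower f K (p + 1)) n) :
    map (fibredPower_baseMap hf p) n (map (fibredPower_forget i) n c) =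
      map (fibredPower_baseMap hf (p + 1)) n c :=
  map_baseMap_reindex hf i.succAbove c

lemma map_baseMap_rho (hf : IsFiniteSurjectiveSimplicial K L f)
    (c : Chain R (fibredPower f K 1) n) :
    map (fibredPower_baseMap hf 0) n (rho R f K 0 n c) = 0 := by
  rw [rho_apply, Fin.sum_univ_two, map_add, map_smul, map_smul, map_baseMap_forget hf,
    map_baseMap_forget hf]
  simp

/-! ### Contraction of the alternating rows -/

/-- The projection `ε` forgetting the last component, on the chains of the fibred powers. -/
noncomputable def forgetLast (R : Type) [CommRing R] (f : E → F) (K : SimplicialComplex ℝ E)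
    (p n : ℕ) : Chain R (fibredPower f K (p + 1)) n →ₗ[R] Chain R (fibredPower f K p) n :=
  map (fibredPower_forget (Fin.last (p + 1))) n

/-- The alternating sum of the insertions of the chosen simplex in all possible places. The sign is
normalised so that the insertion in the last place, which `ε` undoes, has coefficient `1`. -/
noncomputable def alternatingInsert (hf : IsFiniteSurjectiveSimplicial K L f)
    (hg : IsSimplexSection K L f g) (p n : ℕ) :
    Chain R (fibredPower f K p) n →ₗ[R] Chain R (fibredPower f K (p + 1)) n :=
  ∑ j : Fin (p + 2), (-1 : R) ^ (p + 1 + j : ℕ) • insert hf hg j n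

lemma alternatingInsert_apply (hf : IsFiniteSurjectiveSimplicial K L f)
    (hg : IsSimplexSection K L f g) (c : Chain R (fibredPower f K p) n) :
    alternatingInsert hf hg p n c =
      ∑ j : Fin (p + 2), (-1 : R) ^ (p + 1 + j : ℕ) • insert hf hg j n c := by
  simp [alternatingInsert, LinearMap.sum_apply]

lemma forgetLast_alternatingInsert (hf : IsFiniteSurjectiveSimplicial K L f)
    (hg : IsSimplexSection K L f g) (c : Chain R (fibredPower f K (p + 1)) n) :
    forgetLast R f K (p + 1) n (alternatingInsert hf hg (p + 1) n c) =
      c - alternatingInsert hf hg p n (forgetLast R f K p n c) := by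
  rw [alternatingInsert_apply, Fin.sum_univ_castSucc, alternatingInsert_apply, map_add, map_sum,
    sub_eq_add_neg, ← Finset.sum_neg_distrib]
  refine (add_comm _ _).trans ?_
  congr 1
  · rw [map_smul, forgetLast, map_forget_insert_self, Fin.val_last, ← two_mul, pow_mul]
    simp
  · refine Finset.sum_congr rfl fun j _ => ?_
    rw [map_smul, forgetLast, map_forget_insert hf hg (j := j.castSucc) (i := Fin.last _) (j' := j)
      (i' := Fin.last _) (by simp) (by simp [Fin.castSucc_succAbove_castSucc]), ← neg_smul,
      Fin.val_castSucc]
    congr 1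
    ring

lemma forgetLast_alternatingInsert_zero (hf : IsFiniteSurjectiveSimplicial K L f)
    (hg : IsSimplexSection K L f g) (c : Chain R (fibredPower f K 0) n) :
    forgetLast R f K 0 n (alternatingInsert hf hg 0 n c) =
      c - sectionMap hg n (map (fibredPower_baseMap hf 0) n c) := by
  rw [alternatingInsert_apply, Fin.sum_univ_two, map_add, map_smul, map_smul, forgetLast,
    map_forget_insert_zero hf hg (by decide : Fin.last 1 ≠ 0),
    show (1 : Fin 2) = Fin.last 1 from rfl, map_forget_insert_self]
  simp [sub_eq_add_neg, add_comm]

/-- The action of a permutation of the components on a simplex with an inserted component. -/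
lemma map_permute_insert (hf : IsFiniteSurjectiveSimplicial K L f)
    (hg : IsSimplexSection K L f g) (σ : Equiv.Perm (Fin (p + 2))) (i : Fin (p + 2))
    (σ' : Equiv.Perm (Fin (p + 1))) (h : ∀ l, σ (i.succAbove l) = (σ i).succAbove (σ' l))
    (c : Chain R (fibredPower f K p) n) :
    map (fibredPower_reindex σ) n (insert hf hg (σ i) n c) =
      insert hf hg i n (map (fibredPower_reindex σ') n c) := by
  suffices h : (map (fibredPower_reindex σ) n).comp (insert (R := R) hf hg (σ i) n) =
      (insert hf hg i n).comp (map (fibredPower_reindex σ') n) from LinearMap.congr_fun h c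
  refine hom_ext fun v => ?_
  rw [LinearMap.comp_apply, LinearMap.comp_apply, insert_of, map_of, map_of, insert_of]
  have hbase : ∀ a, f ((mapSimplex (fibredPower_reindex σ') v).1 a 0) = f (v.1 a 0) := fun a =>
    v.fibredPower_apply_eq a _ _
  have hset : baseSet (mapSimplex (fibredPower_reindex σ') v) = baseSet v :=
    congrArg Set.range (funext hbase)
  refine congrArg _ (Subtype.ext (funext fun a => funext fun k => ?_))
  change (σ i).insertNth (α := fun _ => E) (g (baseSet v) (f (v.1 a 0))) (v.1 a) (σ k) =
    i.insertNth (α := fun _ => E) (g (baseSet (mapSimplex (fibredPower_reindex σ') v))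
      (f ((mapSimplex (fibredPower_reindex σ') v).1 a 0)))
      ((mapSimplex (fibredPower_reindex σ') v).1 a) k
  rw [hset, hbase]
  rcases Fin.eq_self_or_eq_succAbove i k with rfl | ⟨l, rfl⟩
  · rw [Fin.insertNth_apply_same, Fin.insertNth_apply_same]
  · rw [h, Fin.insertNth_apply_succAbove, Fin.insertNth_apply_succAbove]
    rfl

/-- A chain `c` of the fibred power `W^{p+1}(f)` is alternating if `σ_# c = sign(σ) c` for all
permutations `σ` of the components. -/
def IsAlternating (c : Chain R (fibredPower f K p) n) : Prop :=
  ∀ σ : Equiv.Perm (Fin (p + 1)), map (fibredPower_reindex σ) n c = sgn R σ • c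

lemma IsAlternating.alternatingInsert (hf : IsFiniteSurjectiveSimplicial K L f)
    (hg : IsSimplexSection K L f g) {c : Chain R (fibredPower f K p) n} (hc : IsAlternating c) :
    IsAlternating (alternatingInsert hf hg p n c) := by
  intro σ
  rw [alternatingInsert_apply, map_sum, Finset.smul_sum,
    ← Equiv.sum_comp σ fun j => map (fibredPower_reindex σ) n
      ((-1 : R) ^ (p + 1 + j : ℕ) • insert hf hg j n c)]
  refine Finset.sum_congr rfl fun i _ => ?_
  obtain ⟨σ', h1, h2⟩ := exists_perm_succAbove R σ i
  rw [map_smul, map_permute_insert hf hg σ i σ' h1, hc, map_smul, smul_smul, smul_smul]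
  congr 1
  have h3 : sgn R σ * sgn R σ = 1 := sgn_mul_self R σ
  have h4 : sgn R σ' * sgn R σ' = 1 := sgn_mul_self R σ'
  rw [pow_add, pow_add]
  linear_combination (-1 : R) ^ (p + 1) * (sgn R σ * sgn R σ' * h2 -
    (-1 : R) ^ (i : ℕ) * sgn R σ * h4 + (-1 : R) ^ (σ i : ℕ) * sgn R σ' * h3) * (-1)

end Chain

end RowContractions

end MultiplePoint

namespace MultiplePoint

section AlternatingChains

open Geometry

/-! ### Restricting chains to the simplices with a given property -/

namespace Chain

section Filter

variable {R : Type} [CommRing R] {V : Type} [AddCommGroup V] [Module ℝ V]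
  {K : SimplicialComplex ℝ V} {n : ℕ}

open Classical in
/-- The part of a chain supported on the simplices whose vertex sets satisfy `P`. -/
noncomputable def filter (P : Set V → Prop) : Chain R K n →ₗ[R] Chain R K n :=
  lift (fun v => if P (Set.range v.1) then of R v else 0) fun v τ => by
    rw [v.range_perm, of_perm, smul_ite, smul_zero]

lemma filter_of_pos {P : Set V → Prop} {v : OrderedSimplex K n} (h : P (Set.range v.1)) :
    filter P (of R v) = of R v := (lift_of _ _ _).trans (if_pos h)

lemma filter_of_neg {P : Set V → Prop} {v : OrderedSimplex K n} (h : ¬P (Set.range v.1)) :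
    filter P (of R v) = 0 := (lift_of _ _ _).trans (if_neg h)

lemma filter_eq_self {P : Set V → Prop} (h : ∀ v : OrderedSimplex K n, P (Set.range v.1))
    (c : Chain R K n) : filter P c = c := by
  suffices h : filter P = (LinearMap.id : Chain R K n →ₗ[R] _) from LinearMap.congr_fun h c
  exact hom_ext fun v => filter_of_pos (h v)

lemma filter_add_filter_not (P : Set V → Prop) (c : Chain R K n) :
    filter P c + filter (fun A => ¬P A) c = c := by
  suffices h : filter P + filter (fun A => ¬P A) = (LinearMap.id : Chain R K n →ₗ[R] _) from
    LinearMap.congr_fun h c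
  refine hom_ext fun v => ?_
  by_cases hP : P (Set.range v.1)
  · rw [LinearMap.add_apply, filter_of_pos hP, filter_of_neg (not_not.2 hP), add_zero]; rfl
  · rw [LinearMap.add_apply, filter_of_neg hP, filter_of_pos (P := fun A => ¬P A) hP, zero_add]; rfl

lemma filter_filter (P Q : Set V → Prop) (c : Chain R K n) :
    filter P (filter Q c) = filter (fun A => P A ∧ Q A) c := by
  suffices h : (filter P).comp (filter Q) =
      (filter (fun A => P A ∧ Q A) : Chain R K n →ₗ[R] _) from LinearMap.congr_fun h c
  refine hom_ext fun v => ?_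
  rw [LinearMap.comp_apply]
  by_cases hQ : Q (Set.range v.1)
  · rw [filter_of_pos hQ]
    by_cases hP : P (Set.range v.1)
    · rw [filter_of_pos hP, filter_of_pos (P := fun A => P A ∧ Q A) ⟨hP, hQ⟩]
    · rw [filter_of_neg hP, filter_of_neg (P := fun A => P A ∧ Q A) fun h => hP h.1]
  · rw [filter_of_neg hQ, map_zero, filter_of_neg (P := fun A => P A ∧ Q A) fun h => hQ h.2]

end Filter

end Chain

/-! ### Alternating chains of the fibred powers and of the multiple point spaces -/

namespace Chain

variable {E F : Type} [NormedAddCommGroup E] [NormedSpace ℝ E] {K : SimplicialComplex ℝ E}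
  {f : E → F} {p n : ℕ} {R : Type} [CommRing R]

lemma isAlternating_zero (c : Chain R (fibredPower f K 0) n) : IsAlternating c := by
  intro σ
  rw [show σ = 1 from Subsingleton.elim (α := Equiv.Perm (Fin 1)) σ 1, sgn, Equiv.Perm.sign_one]
  suffices h : map (fibredPower_reindex (1 : Equiv.Perm (Fin 1))) n =
      (LinearMap.id : Chain R (fibredPower f K 0) n →ₗ[R] _) by
    rw [h]; simp
  refine hom_ext fun v => ?_
  rw [map_of]
  rfl

/-- The `i`-th and `j`-th components agree at all points of `A`. -/
def AgreesAt (i j : Fin (p + 1)) (A : Set (Fin (p + 1) → E)) : Prop := ∀ x ∈ A, x i = x j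

/-- No two components agree at all points of `A`. -/
def PairwiseDistinct (A : Set (Fin (p + 1) → E)) : Prop := ∀ i j, i ≠ j → ¬AgreesAt i j A

/-- The part of an alternating chain supported on the simplices whose `i`-th and `j`-th components
agree vanishes: the transposition of `i` and `j` fixes it and changes its sign. -/
lemma IsAlternating.filter_eq_zero [IsDomain R] [CharZero R]
    {c : Chain R (fibredPower f K p) n} (hc : IsAlternating c) {i j : Fin (p + 1)} (hij : i ≠ j) :
    filter (AgreesAt i j) c = 0 := by
  let τ : Equiv.Perm (Fin (p + 1)) := Equiv.swap i j
  have hfix : ∀ x : Fin (p + 1) → E, x i = x j → x ∘ τ = x := by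
    intro x hx
    funext k
    rcases eq_or_ne k i with rfl | hki
    · simp [τ, hx]
    · rcases eq_or_ne k j with rfl | hkj
      · simp [τ, hx]
      · simp [τ, Equiv.swap_apply_of_ne_of_ne hki hkj]
  have hP : ∀ v : OrderedSimplex (fibredPower f K p) n,
      AgreesAt i j (Set.range (mapSimplex (fibredPower_reindex τ) v).1) ↔
        AgreesAt i j (Set.range v.1) := by
    intro v
    simp only [AgreesAt, Set.forall_mem_range]
    refine forall_congr' fun a => ?_
    change v.1 a (τ i) = v.1 a (τ j) ↔ _
    rw [Equiv.swap_apply_left, Equiv.swap_apply_right, eq_comm]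
  have h1 : map (fibredPower_reindex τ) n (filter (AgreesAt i j) c) =
      filter (AgreesAt i j) c := by
    suffices h : (map (fibredPower_reindex τ) n).comp (filter (AgreesAt i j)) =
        (filter (AgreesAt i j) : Chain R (fibredPower f K p) n →ₗ[R] _) from
      LinearMap.congr_fun h c
    refine hom_ext fun v => ?_
    rw [LinearMap.comp_apply]
    by_cases h : AgreesAt i j (Set.range v.1)
    · rw [filter_of_pos h, map_of]
      exact congrArg _ (Subtype.ext (funext fun a => hfix _ (h _ ⟨a, rfl⟩)))
    · rw [filter_of_neg h, map_zero]
  have h2 : map (fibredPower_reindex τ) n (filter (AgreesAt i j) c) =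
      filter (AgreesAt i j) (map (fibredPower_reindex τ) n c) := by
    suffices h : (map (fibredPower_reindex τ) n).comp (filter (AgreesAt i j)) =
        (filter (AgreesAt i j)).comp (map (R := R) (fibredPower_reindex τ) n) from
      LinearMap.congr_fun h c
    refine hom_ext fun v => ?_
    rw [LinearMap.comp_apply, LinearMap.comp_apply, map_of]
    by_cases h : AgreesAt i j (Set.range v.1)
    · rw [filter_of_pos h, map_of,
        filter_of_pos ((hP v).2 h)]
    · rw [filter_of_neg h, map_zero,
        filter_of_neg fun h' => h ((hP v).1 h')]
  refine eq_zero_of_eq_neg ?_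
  have hsgn : sgn R τ = -1 := by simp [sgn, τ, Equiv.Perm.sign_swap hij]
  rw [← map_neg, ← neg_one_smul R c, ← hsgn, ← hc τ, ← h2, h1]

/-- An alternating chain is supported on the simplices with pairwise distinct components. -/
lemma IsAlternating.filter_distinct [IsDomain R] [CharZero R]
    {c : Chain R (fibredPower f K p) n} (hc : IsAlternating c) :
    filter PairwiseDistinct c = c := by
  classical
  have h : ∀ S : Finset (Fin (p + 1) × Fin (p + 1)), (∀ y ∈ S, y.1 ≠ y.2) →
      filter (fun A => ∀ y ∈ S, ¬AgreesAt y.1 y.2 A) c = c := by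
    intro S
    induction S using Finset.induction_on with
    | empty => exact fun _ => filter_eq_self (fun _ _ h => (Finset.notMem_empty _ h).elim) c
    | insert y S _ ih =>
      intro hS
      have h1 : filter (fun A => ¬AgreesAt y.1 y.2 A) c = c := by
        have := filter_add_filter_not (AgreesAt y.1 y.2) c
        rwa [hc.filter_eq_zero (hS y (Finset.mem_insert_self y S)), zero_add] at this
      have h3 := filter_filter (fun A => ¬AgreesAt y.1 y.2 A)
        (fun A => ∀ y ∈ S, ¬AgreesAt y.1 y.2 A) c
      rw [ih fun x hx => hS x (Finset.mem_insert_of_mem hx), h1] at h3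
      simp only [Finset.forall_mem_insert]
      exact h3.symm
  have h' := h (Finset.univ.filter fun x => x.1 ≠ x.2) (by simp)
  simp only [Finset.mem_filter, Finset.mem_univ, true_and, Prod.forall] at h'
  exact h'

/-- The inclusion of the chains of `D^{p+1}(f)` into those of `W^{p+1}(f)`. -/
noncomputable def multiplePointInclusion (R : Type) [CommRing R] (f : E → F)
    (K : SimplicialComplex ℝ E) (p n : ℕ) :
    Chain R (multiplePointComplex f K p) n →ₗ[R] Chain R (fibredPower f K p) n :=
  map (multiplePoint_le_fibredPower f K p) n

open Classical in
/-- The projection of the chains of `W^{p+1}(f)` onto those of `D^{p+1}(f)`, which omits the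
simplices that do not lie in `D^{p+1}(f)`. -/
noncomputable def multiplePointProjection (R : Type) [CommRing R] (f : E → F)
    (K : SimplicialComplex ℝ E) (p n : ℕ) :
    Chain R (fibredPower f K p) n →ₗ[R] Chain R (multiplePointComplex f K p) n :=
  lift (fun v => if h : ∃ s ∈ (multiplePointComplex f K p).faces,
      (s : Set (Fin (p + 1) → E)) = Set.range v.1 then of R ⟨v.1, v.2.1, h⟩ else 0) fun v τ => by
    by_cases h : ∃ s ∈ (multiplePointComplex f K p).faces,
      (s : Set (Fin (p + 1) → E)) = Set.range v.1
    · rw [dif_pos h, dif_pos (by rwa [v.range_perm])]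
      exact of_perm R (⟨v.1, v.2.1, h⟩ : OrderedSimplex (multiplePointComplex f K p) n) τ
    · rw [dif_neg h, dif_neg (by rwa [v.range_perm]), smul_zero]

lemma multiplePointProjection_inclusion (c : Chain R (multiplePointComplex f K p) n) :
    multiplePointProjection R f K p n (multiplePointInclusion R f K p n c) = c := by
  suffices h : (multiplePointProjection R f K p n).comp (multiplePointInclusion R f K p n) =
      LinearMap.id from LinearMap.congr_fun h c
  refine hom_ext fun v => ?_
  rw [LinearMap.comp_apply, multiplePointInclusion, map_of]
  exact (lift_of _ _ _).trans (dif_pos v.2.2)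

lemma multiplePointInclusion_injective :
    Function.Injective (multiplePointInclusion R f K p n) :=
  Function.LeftInverse.injective multiplePointProjection_inclusion

lemma multiplePointInclusion_permute (σ : Equiv.Perm (Fin (p + 1)))
    (c : Chain R (multiplePointComplex f K p) n) :
    multiplePointInclusion R f K p n (map (multiplePoint_permute σ) n c) =
      map (fibredPower_reindex σ) n (multiplePointInclusion R f K p n c) := by
  have h : IsNondegenerateSimplicial (multiplePointComplex f K p) (fibredPower f K p)
    (fun x => x ∘ σ) := fun s hs => fibredPower_reindex σ s hs.1
  rw [multiplePointInclusion, map_map _ _ h fun _ => rfl, map_map _ _ h fun _ => rfl]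

lemma multiplePointInclusion_eps (c : Chain R (multiplePointComplex f K (p + 1)) n) :
    multiplePointInclusion R f K p n (eps R f K p n c) =
      forgetLast R f K p n (multiplePointInclusion R f K (p + 1) n c) := by
  have h : IsNondegenerateSimplicial (multiplePointComplex f K (p + 1)) (fibredPower f K p)
    (forget (Fin.last (p + 1))) := fun s hs => fibredPower_forget _ s hs.1
  exact (map_map (multiplePoint_forget (Fin.last (p + 1))) (multiplePoint_le_fibredPower f K p) h
    (fun _ => rfl) c).trans (map_map (multiplePoint_le_fibredPower f K (p + 1))
      (fibredPower_forget (Fin.last (p + 1))) h (fun _ => rfl) c).symm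

lemma isAlternating_inclusion {c : Chain R (multiplePointComplex f K p) n}
    (hc : c ∈ altChain R f K p n) : IsAlternating (multiplePointInclusion R f K p n c) := by
  intro σ
  rw [← multiplePointInclusion_permute, mem_altChain.1 hc, map_smul]

variable [NormedAddCommGroup F] [NormedSpace ℝ F] {L : SimplicialComplex ℝ F}

lemma map_baseMap_inclusion (hf : IsFiniteSurjectiveSimplicial K L f)
    (c : Chain R (multiplePointComplex f K p) n) :
    map (fibredPower_baseMap hf p) n (multiplePointInclusion R f K p n c) =
      map (multiplePoint_baseMap hf p) n c :=
  map_map _ _ _ (fun _ => rfl) c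

/-- The alternating chains of `W^{p+1}(f)` are those of `D^{p+1}(f)`. -/
lemma IsAlternating.exists_altChain [IsDomain R] [CharZero R]
    (hf : IsFiniteSurjectiveSimplicial K L f) {c : Chain R (fibredPower f K p) n}
    (hc : IsAlternating c) : ∃ b ∈ altChain R f K p n, multiplePointInclusion R f K p n b = c := by
  have h : multiplePointInclusion R f K p n (multiplePointProjection R f K p n c) = c := by
    conv_lhs => rw [← hc.filter_distinct]
    conv_rhs => rw [← hc.filter_distinct]
    suffices h : (multiplePointInclusion R f K p n).comp ((multiplePointProjection R f K p n).comp
        (filter PairwiseDistinct)) =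
        filter PairwiseDistinct from LinearMap.congr_fun h c
    refine hom_ext fun v => ?_
    rw [LinearMap.comp_apply, LinearMap.comp_apply]
    by_cases hv : PairwiseDistinct (Set.range v.1)
    · rw [filter_of_pos hv]
      have hD : ∃ s ∈ (multiplePointComplex f K p).faces,
          (s : Set (Fin (p + 1) → E)) = Set.range v.1 := by
        obtain ⟨s, hs, hsv⟩ := v.2.2
        refine ⟨s, mem_multiplePointComplex hf hs fun i j hij => ?_, hsv⟩
        by_contra! h
        exact hv i j hij fun x hx => h x (Finset.mem_coe.1 (hsv ▸ hx))
      have h1 : multiplePointProjection R f K p n (of R v) =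
          of R (⟨v.1, v.2.1, hD⟩ : OrderedSimplex (multiplePointComplex f K p) n) :=
        (lift_of _ _ _).trans (dif_pos hD)
      exact (congrArg _ h1).trans (map_of _ _)
    · rw [filter_of_neg hv, map_zero, map_zero]
  refine ⟨_, mem_altChain.2 fun σ => multiplePointInclusion_injective ?_, h⟩
  rw [multiplePointInclusion_permute, map_smul, h, hc]

end Chain

end AlternatingChains

end MultiplePoint

namespace MultiplePoint

/-! ### The two double complexes -/

section DoubleComplexes

/-- Exactness of the rows of a double complex obtained by the sign trick, in terms of the morphisms
between the columns: the signs do not affect it. -/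
noncomputable def DoubleComplex.RowResolution.ofSignTrick {R : Type} [CommRing R]
    {K : ℕ → ChainComplex (ModuleCat.{0} R) ℕ} {ρ : ∀ k, K (k + 1) ⟶ K k}
    (hρ : ∀ k, ρ (k + 1) ≫ ρ k = 0) {M : ChainComplex (ModuleCat.{0} R) ℕ} (aug : K 0 ⟶ M)
    (aug_ρ : ∀ n x, (aug.f n).hom (((ρ 0).f n).hom x) = 0)
    (surjective : ∀ n, Function.Surjective (aug.f n).hom)
    (exact_zero : ∀ n x, (aug.f n).hom x = 0 → ∃ y, ((ρ 0).f n).hom y = x)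
    (exact_succ : ∀ n k x, ((ρ k).f n).hom x = 0 → ∃ y, ((ρ (k + 1)).f n).hom y = x) :
    (DoubleComplex.ofSignTrick K ρ hρ).RowResolution M :=
  have hsq : ∀ n, (-1 : R) ^ n * (-1) ^ n = 1 := fun n => by rw [← mul_pow]; simp
  have hdiv : ∀ n k x, (∃ y, ((ρ k).f n).hom y = x) →
      ∃ y, ((-1 : R) ^ n • ((ρ k).f n).hom) y = x := by
    rintro n k _ ⟨y, rfl⟩
    refine ⟨(-1 : R) ^ n • y, ?_⟩
    rw [LinearMap.smul_apply, map_smul, smul_smul, hsq, one_smul]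
  { aug := fun n => (aug.f n).hom
    aug_d' := fun n x => (congrArg (fun φ => φ.hom x) (aug.comm (n + 1) n)).symm
    aug_d'' := fun n (x : (K 1).X n) => by
      suffices h : (aug.f n).hom ((-1 : R) ^ n • ((ρ 0).f n).hom x) = 0 from h
      rw [map_smul, aug_ρ, smul_zero]
    surjective := surjective
    exact_zero := fun n x hx => hdiv n 0 x (exact_zero n x hx)
    exact_succ := fun n k (x : (K (k + 1)).X n) hx => hdiv n (k + 1) x (exact_succ n k x (by
      have hx : (-1 : R) ^ n • ((ρ k).f n).hom x = 0 := hx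
      rw [← one_smul R (((ρ k).f n).hom x), ← hsq n, mul_smul, hx, smul_zero])) }

open Geometry Chain

variable {E F : Type} [NormedAddCommGroup E] [NormedSpace ℝ E] [NormedAddCommGroup F]
  [NormedSpace ℝ F] {K : SimplicialComplex ℝ E} {L : SimplicialComplex ℝ F} {f : E → F}
  (R : Type) [CommRing R]

/-- The augmentation `C_•(W^1(f)) → C_•(Y)`. -/
noncomputable def fibredPowerAugmentation (hf : IsFiniteSurjectiveSimplicial K L f) :
    simplicialChainComplex R (fibredPower f K 0) ⟶ simplicialChainComplex R L :=
  ChainComplex.ofHom (fun n => ModuleCat.ofHom (Chain.map (fibredPower_baseMap hf 0) n))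
    fun n => by
      rw [simplicialChainComplex_d, simplicialChainComplex_d]
      refine (ModuleCat.ofHom_comp _ _).symm.trans (Eq.trans ?_ (ModuleCat.ofHom_comp _ _))
      exact congrArg ModuleCat.ofHom (LinearMap.ext (boundary_map _))

/-- The augmentation `C^Alt_•(D^1(f)) → C_•(Y)`. -/
noncomputable def alternatingAugmentation (hf : IsFiniteSurjectiveSimplicial K L f) :
    altChainComplex R f K 0 ⟶ simplicialChainComplex R L :=
  ChainComplex.ofHom (fun n => ModuleCat.ofHom
      ((Chain.map (multiplePoint_baseMap hf 0) n).comp (altChain R f K 0 n).subtype)) fun n => by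
    rw [altChainComplex_d, simplicialChainComplex_d]
    refine (ModuleCat.ofHom_comp _ _).symm.trans (Eq.trans ?_ (ModuleCat.ofHom_comp _ _))
    exact congrArg ModuleCat.ofHom (LinearMap.ext fun c => boundary_map _ _)

/-- The rows of the fibred power double complex are resolutions of the chains of `Y`. -/
noncomputable def fibredPowerRowResolution (hf : IsFiniteSurjectiveSimplicial K L f) :
    (fibredPowerDoubleComplex R f K).RowResolution (simplicialChainComplex R L) := by
  refine DoubleComplex.RowResolution.ofSignTrick _ (fibredPowerAugmentation R hf) ?_ ?_ ?_ ?_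
  · exact fun n (c : Chain R (fibredPower f K 1) n) => map_baseMap_rho hf c
  · intro n (c : Chain R L n)
    obtain ⟨g, hg⟩ := hf.exists_section
    exact ⟨sectionMap hg n c, map_baseMap_sectionMap hf hg c⟩
  · intro n (c : Chain R (fibredPower f K 0) n) hc
    obtain ⟨g, hg⟩ := hf.exists_section
    have hc : Chain.map (fibredPower_baseMap hf 0) n c = 0 := hc
    refine ⟨insert hf hg 0 n c, (rho_insert_zero_zero hf hg c).trans ?_⟩
    rw [hc, map_zero, sub_zero]
  · intro n k (c : Chain R (fibredPower f K (k + 1)) n) hc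
    obtain ⟨g, hg⟩ := hf.exists_section
    have hc : rho R f K k n c = 0 := hc
    refine ⟨insert hf hg 0 n c, (rho_insert_zero hf hg c).trans ?_⟩
    rw [hc, map_zero, sub_zero]

/-- The transposition of the components changes the sign of an alternating chain of `W^2(f)` but not
its image in `Y`. -/
lemma Chain.IsAlternating.map_baseMap_eq_zero {R : Type} [CommRing R] [IsDomain R] [CharZero R]
    (hf : IsFiniteSurjectiveSimplicial K L f) {n : ℕ} {c : Chain R (fibredPower f K 1) n}
    (hc : IsAlternating c) : Chain.map (fibredPower_baseMap hf 1) n c = 0 := by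
  refine eq_zero_of_eq_neg ?_
  have hsgn : sgn R (Equiv.swap (0 : Fin 2) 1) = -1 := by
    simp [sgn, Equiv.Perm.sign_swap zero_ne_one]
  have h := map_baseMap_reindex hf (Equiv.swap (0 : Fin 2) 1) c
  rw [hc, hsgn, neg_one_smul, map_neg] at h
  exact h.symm

/-- The rows of the alternating double complex are resolutions of the chains of `Y`. -/
noncomputable def alternatingRowResolution [IsDomain R] [CharZero R]
    (hf : IsFiniteSurjectiveSimplicial K L f) :
    (alternatingDoubleComplex R f K).RowResolution (simplicialChainComplex R L) := by
  refine DoubleComplex.RowResolution.ofSignTrick _ (alternatingAugmentation R hf) ?_ ?_ ?_ ?_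
  · intro n (c : altChain R f K 1 n)
    suffices h : Chain.map (multiplePoint_baseMap hf 0) n (eps R f K 0 n c.1) = 0 from h
    rw [← map_baseMap_inclusion hf, multiplePointInclusion_eps, forgetLast, map_baseMap_forget hf]
    exact (isAlternating_inclusion c.2).map_baseMap_eq_zero hf
  · intro n (c : Chain R L n)
    obtain ⟨g, hg⟩ := hf.exists_section
    obtain ⟨b, hb, hbc⟩ := (isAlternating_zero (sectionMap hg n c)).exists_altChain hf
    refine ⟨(⟨b, hb⟩ : altChain R f K 0 n), ?_⟩
    suffices h : Chain.map (multiplePoint_baseMap hf 0) n b = c from h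
    rw [← map_baseMap_inclusion hf, hbc, map_baseMap_sectionMap hf]
  · intro n (c : altChain R f K 0 n) hc
    obtain ⟨g, hg⟩ := hf.exists_section
    have hc : Chain.map (multiplePoint_baseMap hf 0) n c.1 = 0 := hc
    have halt := isAlternating_inclusion c.2
    obtain ⟨b, hb, hbc⟩ := (halt.alternatingInsert hf hg).exists_altChain hf
    refine ⟨(⟨b, hb⟩ : altChain R f K 1 n), Subtype.ext (multiplePointInclusion_injective ?_)⟩
    suffices h : multiplePointInclusion R f K 0 n (eps R f K 0 n b) =
      multiplePointInclusion R f K 0 n c from h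
    rw [multiplePointInclusion_eps, hbc, forgetLast_alternatingInsert_zero,
      map_baseMap_inclusion hf, hc, map_zero, sub_zero]
  · intro n k (c : altChain R f K (k + 1) n) hc
    obtain ⟨g, hg⟩ := hf.exists_section
    have hc : eps R f K k n c = 0 := congrArg Subtype.val hc
    have halt := isAlternating_inclusion c.2
    obtain ⟨b, hb, hbc⟩ := (halt.alternatingInsert hf hg).exists_altChain hf
    refine ⟨(⟨b, hb⟩ : altChain R f K (k + 2) n), Subtype.ext (multiplePointInclusion_injective ?_)⟩
    suffices h : multiplePointInclusion R f K (k + 1) n (eps R f K (k + 1) n b) =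
      multiplePointInclusion R f K (k + 1) n c from h
    rw [multiplePointInclusion_eps, hbc, forgetLast_alternatingInsert, ← multiplePointInclusion_eps,
      hc, map_zero, map_zero, sub_zero]

end DoubleComplexes

end MultiplePoint

theorem corollary3p2 {N P : ℕ}
    (K : Geometry.SimplicialComplex ℝ (EuclideanSpace ℝ (Fin N)))
    (L : Geometry.SimplicialComplex ℝ (EuclideanSpace ℝ (Fin P)))
    (hK : MultiplePoint.IsLocallyFinite K)
    (f : EuclideanSpace ℝ (Fin N) → EuclideanSpace ℝ (Fin P))
    (hf : MultiplePoint.IsFiniteSurjectiveSimplicial K L f) :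
    ((∃ e : ∀ p q : ℕ,
          ((MultiplePoint.gvzSpectralSequence ℤ f K).page 1).X ((p : ℤ), (q : ℤ)) ≅
            (MultiplePoint.simplicialChainComplex ℤ (MultiplePoint.fibredPower f K p)).homology q,
        ∀ p q : ℕ,
          ((MultiplePoint.gvzSpectralSequence ℤ f K).page 1).d
              (((p + 1 : ℕ) : ℤ), (q : ℤ)) ((p : ℤ), (q : ℤ)) ≫ (e p q).hom =
            (e (p + 1) q).hom ≫
              ((-1 : ℤ) ^ q • HomologicalComplex.homologyMap (MultiplePoint.rhoHom ℤ f K p) q)) ∧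
      MultiplePoint.ConvergesTo (MultiplePoint.gvzSpectralSequence ℤ f K)
        fun n => (MultiplePoint.simplicialChainComplex ℤ L).homology n) ∧
    ((∃ e : ∀ p q : ℕ,
          ((MultiplePoint.imageComputingSpectralSequence ℤ f K).page 1).X ((p : ℤ), (q : ℤ)) ≅
            (MultiplePoint.altChainComplex ℤ f K p).homology q,
        ∀ p q : ℕ,
          ((MultiplePoint.imageComputingSpectralSequence ℤ f K).page 1).d
              (((p + 1 : ℕ) : ℤ), (q : ℤ)) ((p : ℤ), (q : ℤ)) ≫ (e p q).hom =
            (e (p + 1) q).hom ≫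
              ((-1 : ℤ) ^ q • HomologicalComplex.homologyMap (MultiplePoint.epsHom ℤ f K p) q)) ∧
      MultiplePoint.ConvergesTo (MultiplePoint.imageComputingSpectralSequence ℤ f K)
        fun n => (MultiplePoint.simplicialChainComplex ℤ L).homology n) := by
  exact ⟨⟨⟨fun p q => (MultiplePoint.DoubleComplex.firstPageEquiv _ _ _ p q).toModuleIso,
      fun p q => MultiplePoint.DoubleComplex.firstPage_d _ _ _ le_rfl p q⟩,
      (MultiplePoint.fibredPowerRowResolution ℤ hf).convergesTo⟩,
    ⟨⟨fun p q => (MultiplePoint.DoubleComplex.firstPageEquiv _ _ _ p q).toModuleIso,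
      fun p q => MultiplePoint.DoubleComplex.firstPage_d _ _ _ le_rfl p q⟩,
      (MultiplePoint.alternatingRowResolution ℤ hf).convergesTo⟩⟩
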